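/- **Theorem (Local linear convergence of the linearized augmented Lagrangian method).** *Problem.* Consider $\min_{x\in\mathbb R^n} g(x)+h(x)$ subject to $Ax=b$ and $f_j(x)\le 0$, $j\in[m]=\{1,\dots,m\}$, where $A\in\mathbb R^{p\times n}$, $b\in\mathbb R^p$, $h=\iota_{\mathcal X}$ is the indicator function of a closed convex set $\mathcal X$, and $g,f_1,\dots,f_m:\mathbb R^n\to\mathbb R$ are convex and twice continuously differentiable. Assume that there are constants $L_g,L_j,B_j$ such that, on $\mathcal X$, $\nabla g$ is $L_g$-Lipschitz, $\nabla f_j$ is $L_j$-Lipschitz and $\|\nabla f_j\|\le B_j$ for every $j$. All norms are Euclidean, $\|A\|$ is the spectral norm, and $[a]_+=\max(0,a)$. For $\beta>0$ let $\psi_\beta(u,v)=uv+\frac\beta2u^2$ if $\beta u+v\ge0$ and $\psi_\beta(u,v)=-\frac{v^2}{2\beta}$ otherwise, let $$F_\beta(x,y,z)=g(x)+y^\top(Ax-b)+\tfrac\beta2\|Ax-b\|^2+\sum_{j=1}^m\psi_\beta(f_j(x),z_j),$$ and let $\mathcal L_\beta=F_\beta+h$ be the augmented Lagrangian, so that $\nabla_x^2\mathcal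 L_\beta=\nabla_x^2F_\beta$ wherever $x\in\mathrm{int}(\mathcal X)$ and $F_\beta$ is twice differentiable in $x$. *Nondegenerate KKT point.* Let $w^*=(x^*,y^*,z^*)$ satisfy $0\in\nabla g(x^*)+\partial h(x^*)+A^\top y^*+\sum_jz_j^*\nabla f_j(x^*)$, $Ax^*=b$, and $z^*_j\ge0$, $f_j(x^*)\le0$, $z_j^*f_j(x^*)=0$ for all $j$. Suppose that $x^*\in\mathrm{int}(\mathcal X)$ and that for some $J\subseteq[m]$: 1. $f_j(x^*)=0$ and $z_j^*>0$ for $j\in J$, while $f_j(x^*)<0$ and $z_j^*=0$ for $j\notin J$; 2. $v^\top\big(\nabla^2g(x^*)+\sum_{j\in J}z_j^*\nabla^2f_j(x^*)\big)v>0$ for every $v\neq0$ with $Av=0$ and $\nabla f_j(x^*)^\top v=0$ for all $j\in J$. Let $J\subseteq K\subseteq[m]$ (for instance $K=J$ or $K=[m]$) and suppose that the matrix $D=[A^\top,(\nabla f_j(x^*))_{j\in K}]$ has at least one column and has full column rank. Let $\mu$ be the smallest eigenvalue of $\nabla_x^2\mathcal L_\beta(w^*)$ and $\nu$ the smallest eigenvalue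 of $D^\top D$. Then $\mu>0$ and $\nu>0$, and there is an *admissible radius*, that is, a $\gamma>0$ such that for all $x,\hat x$, $y$, $z,\hat z$ within distance $\gamma$ of $x^*$, $y^*$, $z^*$ respectively: $x\in\mathrm{int}(\mathcal X)$; $\nabla_x^2\mathcal L_\beta(x,y,z)\succeq\frac\mu2I$; $\beta f_j(x)+z_j>0$ for $j\in J$; $\beta f_j(x)+z_j<0$ for $j\notin J$; and $$\Big|\sum_{j\in J}L_j(\beta f_j(x)+z_j)-\sum_{j\in J}L_j(\beta f_j(\hat x)+\hat z_j)\Big|\le\frac\mu8 .$$ *Algorithm.* Let $\delta>0$ and $\rho_y=\rho_z=\frac\beta2$. From $w^0=(x^0,y^0,z^0)$ and with $\eta^{-1}=0$, the method generates $w^k=(x^k,y^k,z^k)$, $k\ge0$, by $$L_F^k=L_g+\beta\|A\|^2+\sum_{j=1}^m\big(\beta B_j^2+L_j[\beta f_j(x^k)+z^k_j]_+\big),\qquad \eta^k=\max(\eta^{k-1},L_F^k+\delta),$$ $$x^{k+1}=\arg\min_x\; h(x)+\langle\nabla_xF_\beta(w^k),x\rangle+\tfrac{\eta^k}2\|x-x^k\|^2,$$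 $$y^{k+1}=y^k+\rho_y(Ax^{k+1}-b),\qquad z_j^{k+1}=z_j^k+\rho_z\max\big(-\tfrac{z_j^k}\beta,\,f_j(x^{k+1})\big).$$ *Initial point.* Let $\gamma$ be any admissible radius, write $d_x=\|x^0-x^*\|$, $d_y=\|y^0-y^*\|$, $d_z=\|z^0-z^*\|$, and let $\bar\eta$ be any number with $$\bar\eta\ge\delta+L_g+\beta\|A\|^2+\beta\sum_jB_j^2+\beta\sum_jB_jL_j\Big(d_x+\frac{d_y}{\sqrt{\rho_y\eta^0}}+\frac{d_z}{\sqrt{\rho_z\eta^0}}\Big)+\sqrt{\sum_jL_j^2}\Big(\sqrt{\rho_z\bar\eta}\,d_x+\sqrt{\tfrac{\rho_z\bar\eta}{\rho_y\eta^0}}\,d_y+\|z^*\|+\max\big(1,\sqrt{\tfrac{\bar\eta}{\eta^0}}\big)d_z\Big).$$ With $\underline\eta=L_g+\beta\|A\|^2+\sum_j\beta B_j^2$, suppose that $$d_x^2+\frac{d_y^2}{\rho_y\underline\eta}+\frac{d_z^2}{\rho_z\underline\eta}\le\gamma^2\min\Big(1,\frac1{\rho_y\bar\eta},\frac1{\rho_z\bar\eta}\Big).$$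 *Conclusion.* Let $C=L_g^2+2|J|\big(\sum_{j\in J}\beta^2B_j^4+2L_{\max}^2(\|z^*\|^2+\gamma^2)\big)$ with $L_{\max}=\max_jL_j$. For every $\alpha$ with $$0<\alpha<\min\Big(\frac\mu{8C},\ \frac\delta{\bar\eta^2},\ \frac1{\beta\|A\|^2}\Big)$$ (where $c/0=+\infty$ for $c>0$), the number $$\sigma=\max\Big(\frac{\alpha C+\bar\eta}{\frac\mu8+\bar\eta},\ 1-\frac{\alpha\beta\nu}8\Big)$$ satisfies $\sigma<1$, and $\phi^{k+1}\le\sigma\,\phi^k$ for all $k\ge0$, where $$\phi^k=\Big(\frac\mu{16}+\frac{\eta^k}2\Big)\|x^k-x^*\|^2+\frac1\beta\big(\|y^k-y^*\|^2+\|z^k-z^*\|^2\big).$$ -/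

import Mathlib

open scoped Matrix Matrix.Norms.L2Operator RealInnerProductSpace

noncomputable section

/-- The Euclidean space `ℝⁿ`. -/
abbrev Vec (n : ℕ) : Type := EuclideanSpace ℝ (Fin n)

/-- The data of the problem: minimize `g x + h x` subject to `A x = b` and `f j x ≤ 0` for all `j`,
with `n` variables, `p` affine equations and `m` nonlinear inequalities. -/
structure Program (n p m : ℕ) where
  g : Vec n → ℝ
  h : Vec n → EReal
  A : Matrix (Fin p) (Fin n) ℝ
  b : Vec p
  f : Fin m → Vec n → ℝ

/-- The indicator function `ι_X` of convex analysis: `0` on `X` and `+∞` outside. -/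
def indicatorFn {n : ℕ} (X : Set (Vec n)) : Vec n → EReal := fun x =>
  open Classical in if x ∈ X then 0 else ⊤

/-- The effective domain of an extended-real-valued function. -/
def effDom {n : ℕ} (h : Vec n → EReal) : Set (Vec n) := {x | h x < ⊤}

/-- The convex subdifferential `∂h(x)` (empty outside the effective domain). -/
def subdiff {n : ℕ} (h : Vec n → EReal) (x : Vec n) : Set (Vec n) :=
  {v | x ∈ effDom h ∧ ∀ u, h x + ((⟪v, u - x⟫ : ℝ) : EReal) ≤ h u}

/-- The Hessian of `φ` at `x`, as a linear operator: the derivative of the gradient. -/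
def hess {n : ℕ} (φ : Vec n → ℝ) (x : Vec n) : Vec n →L[ℝ] Vec n :=
  fderiv ℝ (gradient φ) x

/-- The function `ψ_β(u, v)` in the classic augmented Lagrangian. -/
def psi (β u v : ℝ) : ℝ :=
  if 0 ≤ β * u + v then u * v + β / 2 * u ^ 2 else -(v ^ 2 / (2 * β))

namespace Program

variable {n p m : ℕ} (P : Program n p m)

/-- The residual `A x - b`. -/
def res (x : Vec n) : Vec p := WithLp.toLp 2 (P.A *ᵥ x.ofLp) - P.b

/-- `Aᵀ y`, as a vector of `ℝⁿ`. -/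
def adj (y : Vec p) : Vec n := WithLp.toLp 2 (P.Aᵀ *ᵥ y.ofLp)

/-- The KKT conditions at `(x, y, z)`. The first one reads
`0 ∈ ∇g(x) + ∂h(x) + Aᵀ y + ∑ z_j ∇f_j(x)`. -/
structure IsKKT (x : Vec n) (y : Vec p) (z : Vec m) : Prop where
  stationary : ∃ v ∈ subdiff P.h x,
    gradient P.g x + v + P.adj y + ∑ j, z j • gradient (P.f j) x = 0
  eq_constr : P.res x = 0
  multiplier_nonneg : ∀ j, 0 ≤ z j
  ineq_constr : ∀ j, P.f j x ≤ 0
  complementary : ∀ j, z j * P.f j x = 0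

/-- `Lg`, `L j` are Lipschitz constants of `∇g`, `∇f_j` on `dom h`, and `B j` bounds `‖∇f_j‖`
on `dom h`. -/
structure LipData (Lg : ℝ) (L B : Fin m → ℝ) : Prop where
  lip_g : ∀ x ∈ effDom P.h, ∀ x' ∈ effDom P.h,
    ‖gradient P.g x - gradient P.g x'‖ ≤ Lg * ‖x - x'‖
  lip_f : ∀ j, ∀ x ∈ effDom P.h, ∀ x' ∈ effDom P.h,
    ‖gradient (P.f j) x - gradient (P.f j) x'‖ ≤ L j * ‖x - x'‖
  bound_f : ∀ j, ∀ x ∈ effDom P.h, ‖gradient (P.f j) x‖ ≤ B j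

/-- The smooth part `F_β(x, y, z) = 𝓛_β(x, y, z) - h(x)` of the augmented Lagrangian. -/
def F (β : ℝ) (x : Vec n) (y : Vec p) (z : Vec m) : ℝ :=
  P.g x + ⟪y, P.res x⟫ + β / 2 * ‖P.res x‖ ^ 2 + ∑ j, psi β (P.f j x) (z j)

/-- `∇_x F_β(x, y, z)`. -/
def gradF (β : ℝ) (x : Vec n) (y : Vec p) (z : Vec m) : Vec n :=
  gradient (fun u => P.F β u y z) x

/-- `∇²_x F_β(x, y, z)`. At a point `x` of the interior of `X`, and for `h = ι_X`, the function
`h` vanishes around `x`, so this is also the Hessian `∇²_x 𝓛_β(x, y, z)` of the augmented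
Lagrangian. -/
def hessF (β : ℝ) (x : Vec n) (y : Vec p) (z : Vec m) : Vec n →L[ℝ] Vec n :=
  hess (fun u => P.F β u y z) x

/-- `L_F(x, z) = L_g + β‖A‖² + ∑_j (β B_j² + L_j [β f_j(x) + z_j]_+)`, where `‖A‖` is the spectral
norm. -/
def LF (β Lg : ℝ) (L B : Fin m → ℝ) (x : Vec n) (z : Vec m) : ℝ :=
  Lg + β * ‖P.A‖ ^ 2 + ∑ j, (β * B j ^ 2 + L j * max 0 (β * P.f j x + z j))

/-- `(x k, y k, z k)` is a run of the linearized augmented Lagrangian method with penalty `β`,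
dual step sizes `ρy`, `ρz`, margin `δ`, and proximal parameters `η k`
(with `η^{-1} = 0`). -/
structure IsLALM (β ρy ρz δ Lg : ℝ) (L B : Fin m → ℝ)
    (x : ℕ → Vec n) (y : ℕ → Vec p) (z : ℕ → Vec m) (η : ℕ → ℝ) : Prop where
  eta_zero : η 0 = max 0 (P.LF β Lg L B (x 0) (z 0) + δ)
  eta_succ : ∀ k, η (k + 1) = max (η k) (P.LF β Lg L B (x (k + 1)) (z (k + 1)) + δ)
  x_step : ∀ k, IsMinOn
    (fun u => P.h u +
      ((⟪P.gradF β (x k) (y k) (z k), u⟫ + η k / 2 * ‖u - x k‖ ^ 2 : ℝ) : EReal))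
    Set.univ (x (k + 1))
  y_step : ∀ k, y (k + 1) = y k + ρy • P.res (x (k + 1))
  z_step : ∀ k j, z (k + 1) j = z k j + ρz * max (-(z k j / β)) (P.f j (x (k + 1)))

/-- The matrix `D = [Aᵀ, (∇f_j(x))_{j ∈ K}]`. -/
def D (K : Finset (Fin m)) (x : Vec n) : Matrix (Fin n) (Fin p ⊕ K) ℝ :=
  Matrix.fromCols P.Aᵀ (Matrix.of fun i (j : K) => (gradient (P.f j) x) i)

/-- The radius `γ > 0` is admissible: on the closed `γ`-balls around `x*`, `y*`, `z*`, the point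
`x` is interior to `X`, `∇²_x 𝓛_β ⪰ (μ/2) I`, the signs of `β f_j + z_j` identify `J`, and
`∑_{j ∈ J} L_j (β f_j + z_j)` oscillates by at most `μ/8`. -/
structure AdmissibleRadius (X : Set (Vec n)) (J : Finset (Fin m)) (β μ : ℝ) (L : Fin m → ℝ)
    (xs : Vec n) (ys : Vec p) (zs : Vec m) (γ : ℝ) : Prop where
  pos : 0 < γ
  interior : ∀ x, ‖x - xs‖ ≤ γ → x ∈ interior X
  hessian : ∀ x y z, ‖x - xs‖ ≤ γ → ‖y - ys‖ ≤ γ → ‖z - zs‖ ≤ γ →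
    ∀ v, μ / 2 * ‖v‖ ^ 2 ≤ ⟪v, P.hessF β x y z v⟫
  sign_pos : ∀ x z, ‖x - xs‖ ≤ γ → ‖z - zs‖ ≤ γ → ∀ j ∈ J, 0 < β * P.f j x + z j
  sign_neg : ∀ x z, ‖x - xs‖ ≤ γ → ‖z - zs‖ ≤ γ → ∀ j ∉ J, β * P.f j x + z j < 0
  osc : ∀ x x' z z', ‖x - xs‖ ≤ γ → ‖x' - xs‖ ≤ γ → ‖z - zs‖ ≤ γ → ‖z' - zs‖ ≤ γ →
    |∑ j ∈ J, L j * (β * P.f j x + z j) - ∑ j ∈ J, L j * (β * P.f j x' + z' j)| ≤ μ / 8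

/-- `ηb` satisfies the inequality that makes it an upper bound of the proximal parameters.
Here `dx = ‖x⁰ - x*‖`, `dy = ‖y⁰ - y*‖`, `dz = ‖z⁰ - z*‖`, `nz = ‖z*‖` and `η0 = η⁰`. -/
def EtaBarCond (β ρy ρz δ Lg : ℝ) (L B : Fin m → ℝ) (dx dy dz nz η0 ηb : ℝ) : Prop :=
  δ + Lg + β * ‖P.A‖ ^ 2 + β * ∑ j, B j ^ 2
    + β * (∑ j, B j * L j) * (dx + dy / √(ρy * η0) + dz / √(ρz * η0))
    + √(∑ j, L j ^ 2) *
      (√(ρz * ηb) * dx + √(ρz * ηb / (ρy * η0)) * dy + nz + max 1 √(ηb / η0) * dz) ≤ ηb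

/-- `L_g + β‖A‖² + ∑_j β B_j²`. -/
def etaLow (β Lg : ℝ) (B : Fin m → ℝ) : ℝ := Lg + β * ‖P.A‖ ^ 2 + ∑ j, β * B j ^ 2

/-- The condition that the initial point is close to `(x*, y*, z*)`. -/
def InitCond (β ρy ρz Lg : ℝ) (B : Fin m → ℝ) (dx dy dz γ ηb : ℝ) : Prop :=
  dx ^ 2 + 1 / (ρy * P.etaLow β Lg B) * dy ^ 2 + 1 / (ρz * P.etaLow β Lg B) * dz ^ 2
    ≤ γ ^ 2 * min 1 (min (1 / (ρy * ηb)) (1 / (ρz * ηb)))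

end Program

/-- `C = L_g² + 2|J| (∑_{j ∈ J} β² B_j⁴ + 2 L_max² (‖z*‖² + γ²))` with `L_max = max_j L_j`
and `nz = ‖z*‖`. -/
def rateConst {m : ℕ} (J : Finset (Fin m)) (β Lg : ℝ) (L B : Fin m → ℝ) (nz γ : ℝ) : ℝ :=
  Lg ^ 2 + 2 * (J.card : ℝ) *
    (∑ j ∈ J, β ^ 2 * B j ^ 4 + 2 * (⨆ j, L j) ^ 2 * (nz ^ 2 + γ ^ 2))

/-- The contraction factor `σ = max((αC + η̄)/(μ/8 + η̄), 1 - αβν/8)`. -/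
def rateFactor (α β μ ν C ηb : ℝ) : ℝ :=
  max ((α * C + ηb) / (μ / 8 + ηb)) (1 - α * β * ν / 8)

/-- The Lyapunov quantity
`(μ/16 + η/2)‖x - x*‖² + (1/β)(‖y - y*‖² + ‖z - z*‖²)`. -/
def lyapunov {n p m : ℕ} (β μ η : ℝ) (xs : Vec n) (ys : Vec p) (zs : Vec m)
    (x : Vec n) (y : Vec p) (z : Vec m) : ℝ :=
  (μ / 16 + η / 2) * ‖x - xs‖ ^ 2 + 1 / β * (‖y - ys‖ ^ 2 + ‖z - zs‖ ^ 2)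

end

/-!
The method is a proximal gradient step in `x` on the augmented Lagrangian `F_β`, followed by a dual
ascent step of length `β / 2`, half of the penalty.

*Basic inequality* (`Program.IsKKT.step_le`). The function `F_β(·, y, z)` is convex, and its
quadratic upper model at `x` on `X` has curvature `L_F(x, z)`, because `u ↦ ψ_β(u, v)` is convex,
nondecreasing and has a `β`-Lipschitz derivative. With `ψ_β(u, v) = v t + (β/2) t²` for
`t = max (-v/β) u`, the change of the dual distances is exactly what turns
`F_β(x⁺, y, z) - F_β(x*, y, z)` into at least the gain `stepGain` of the step, a Lagrangian gap at
`(y*, z*)` plus half of the penalty. Hence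
`(η/2)‖x⁺ - x*‖² + (1/β)(‖y⁺ - y*‖² + ‖z⁺ - z*‖²)` is at most its old value, minus
`(δ/2)‖x⁺ - x‖²`, the convexity gap `(β/2)‖A(x - x*)‖²` and `stepGain ≥ 0`.

*Boundedness.* Dividing by the nondecreasing `η` gives a nonincreasing weighted distance, so that
`η^k ≤ η̄` (`Program.IsLALM.eta_le`) and all iterates stay within the admissible radius
(`Program.IsLALM.mem_ball`).

*Linear rate* (`Program.IsKKT.contraction`). Within that radius, half of `stepGain` is an augmented
Lagrangian gap at the optimal multipliers, which grows quadratically. This yields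
`(μ/8)‖x⁺ - x*‖²` and, through the inactive multipliers, `∑_{j ∉ J} z_j² / (4β)`
(`Program.IsKKT.le_stepGain`). For the other multipliers, `x⁺` is interior, so
`∇_x F_β(x, y, z) = -η (x⁺ - x)`. Subtracting stationarity at the KKT point writes
`Aᵀ(y - y*) + ∑_{j ∈ J} (z_j - z*_j) ∇f_j(x*)` as a sum of four terms, and full column rank of `D`
bounds the dual error by them (`Program.IsKKT.dual_error_le`). The conditions on `α` let
`(δ/2)‖x⁺ - x‖²` and `(β/2)‖A(x - x*)‖²` absorb two of the terms, and `αC/2 · ‖x - x*‖²` pays for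
the others. The increase of `η` costs at most `μ/16 · ‖x⁺ - x*‖²`
(`Program.IsLALM.eta_succ_le`), half of the primal gain.
-/

noncomputable section

/-! ### Inequalities between a function and its gradient -/

section Calculus

variable {E : Type*} [NormedAddCommGroup E] [InnerProductSpace ℝ E] [CompleteSpace E]

lemma HasGradientAt.hasDerivAt_line {f : E → ℝ} {G x d : E} {t : ℝ}
    (h : HasGradientAt f G (x + t • d)) :
    HasDerivAt (fun s : ℝ => f (x + s • d)) ⟪G, d⟫ t := by
  have h1 : HasDerivAt (fun s : ℝ => x + s • d) d t := by
    simpa using ((hasDerivAt_id t).smul_const d).const_add x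
  have h2 := h.hasFDerivAt.comp_hasDerivAt t h1
  simpa [Function.comp_def] using h2

lemma le_add_half_of_hasDerivAt {φ φ' : ℝ → ℝ} {c : ℝ}
    (h : ∀ t ∈ Set.Icc (0 : ℝ) 1, HasDerivAt φ (φ' t) t)
    (hc : ∀ t ∈ Set.Icc (0 : ℝ) 1, φ' t ≤ φ' 0 + c * t) :
    φ 1 ≤ φ 0 + φ' 0 + c / 2 := by
  have hd : ∀ t ∈ Set.Icc (0 : ℝ) 1, HasDerivAt
      (fun t => φ t - φ' 0 * t - c / 2 * t ^ 2) (φ' t - φ' 0 * 1 - c / 2 * (2 * t)) t := by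
    intro t ht
    have h2 : HasDerivAt (fun t : ℝ => t ^ 2) (2 * t) t := by simpa using hasDerivAt_pow 2 t
    exact ((h t ht).sub ((hasDerivAt_id t).const_mul _)).sub (h2.const_mul _)
  have hanti : AntitoneOn (fun t => φ t - φ' 0 * t - c / 2 * t ^ 2) (Set.Icc 0 1) := by
    refine antitoneOn_of_deriv_nonpos (convex_Icc 0 1)
      (fun t ht => (hd t ht).continuousAt.continuousWithinAt) ?_ ?_
    · intro t ht
      exact (hd t (interior_subset ht)).differentiableAt.differentiableWithinAt
    · intro t ht
      rw [(hd t (interior_subset ht)).deriv]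
      linarith [hc t (interior_subset ht)]
  have := hanti (Set.left_mem_Icc.2 zero_le_one) (Set.right_mem_Icc.2 zero_le_one) zero_le_one
  norm_num at this
  linarith

/-- The descent lemma on a convex set. -/
lemma le_add_inner_of_lipschitz_gradient {X : Set E} (hX : Convex ℝ X) {f : E → ℝ} {f' : E → E}
    {L : ℝ} (hf : ∀ u ∈ X, HasGradientAt f (f' u) u)
    (hL : ∀ u ∈ X, ∀ v ∈ X, ‖f' u - f' v‖ ≤ L * ‖u - v‖) {x y : E} (hx : x ∈ X) (hy : y ∈ X) :
    f y ≤ f x + ⟪f' x, y - x⟫ + L / 2 * ‖y - x‖ ^ 2 := by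
  have hmem : ∀ t ∈ Set.Icc (0 : ℝ) 1, x + t • (y - x) ∈ X := fun t ht =>
    hX.add_smul_sub_mem hx hy ht
  have key := le_add_half_of_hasDerivAt (φ := fun t : ℝ => f (x + t • (y - x)))
    (φ' := fun t : ℝ => ⟪f' (x + t • (y - x)), y - x⟫) (c := L * ‖y - x‖ ^ 2)
    (fun t ht => (hf _ (hmem t ht)).hasDerivAt_line) (fun t ht => by
      have h1 := hL _ (hmem t ht) x hx
      have h2 : ‖x + t • (y - x) - x‖ = t * ‖y - x‖ := by
        rw [add_sub_cancel_left, norm_smul, Real.norm_of_nonneg ht.1]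
      rw [h2] at h1
      have h3 : ⟪f' (x + t • (y - x)) - f' x, y - x⟫ ≤ L * (t * ‖y - x‖) * ‖y - x‖ :=
        (real_inner_le_norm _ _).trans (mul_le_mul_of_nonneg_right h1 (norm_nonneg _))
      rw [inner_sub_left] at h3
      simp only [zero_smul, add_zero]
      linarith)
  simp only [one_smul, zero_smul, add_zero, add_sub_cancel] at key
  linarith

/-- Quadratic growth along a segment on which the second derivative is bounded below. -/
lemma add_inner_add_le_of_hessian_ge {f : E → ℝ} {f' : E → E} {H : E → E →L[ℝ] E} {m : ℝ}
    {x y : E}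
    (hf : ∀ t ∈ Set.Icc (0 : ℝ) 1, HasGradientAt f (f' (x + t • (y - x))) (x + t • (y - x)))
    (hf' : ∀ t ∈ Set.Icc (0 : ℝ) 1, HasFDerivAt f' (H (x + t • (y - x))) (x + t • (y - x)))
    (hH : ∀ t ∈ Set.Icc (0 : ℝ) 1,
      m * ‖y - x‖ ^ 2 ≤ ⟪y - x, H (x + t • (y - x)) (y - x)⟫) :
    f x + ⟪f' x, y - x⟫ + m / 2 * ‖y - x‖ ^ 2 ≤ f y := by
  have hd : ∀ t ∈ Set.Icc (0 : ℝ) 1, HasDerivAt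
      (fun s : ℝ => ⟪f' (x + s • (y - x)), y - x⟫)
      ⟪H (x + t • (y - x)) (y - x), y - x⟫ t := by
    intro t ht
    have h1 : HasDerivAt (fun s : ℝ => x + s • (y - x)) (y - x) t := by
      simpa using ((hasDerivAt_id t).smul_const (y - x)).const_add x
    have h2 := ((hf' t ht).comp_hasDerivAt t h1).inner ℝ (hasDerivAt_const t (y - x))
    simpa using h2
  have hgrad : ∀ t ∈ Set.Icc (0 : ℝ) 1,
      m * ‖y - x‖ ^ 2 * (t - 0) ≤
        ⟪f' (x + t • (y - x)), y - x⟫ - ⟪f' (x + (0 : ℝ) • (y - x)), y - x⟫ := by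
    intro t ht
    refine (convex_Icc (0 : ℝ) 1).mul_sub_le_image_sub_of_le_deriv
      (f := fun s : ℝ => ⟪f' (x + s • (y - x)), y - x⟫)
      (fun t ht => (hd t ht).continuousAt.continuousWithinAt)
      (fun t ht => (hd t (interior_subset ht)).differentiableAt.differentiableWithinAt)
      (fun s hs => ?_) 0 (Set.left_mem_Icc.2 zero_le_one) t ht ht.1
    rw [(hd s (interior_subset hs)).deriv, real_inner_comm]
    exact hH s (interior_subset hs)
  have key := le_add_half_of_hasDerivAt (φ := fun t : ℝ => -f (x + t • (y - x)))
    (φ' := fun t : ℝ => -⟪f' (x + t • (y - x)), y - x⟫) (c := -(m * ‖y - x‖ ^ 2))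
    (fun t ht => (hf t ht).hasDerivAt_line.neg) (fun t ht => by linarith [hgrad t ht])
  simp only [one_smul, zero_smul, add_zero, add_sub_cancel] at key
  linarith

lemma ConvexOn.add_inner_gradient_le {f : E → ℝ} (hf : ConvexOn ℝ Set.univ f) {G x : E}
    (h : HasGradientAt f G x) (y : E) : f x + ⟪G, y - x⟫ ≤ f y := by
  have hc : ConvexOn ℝ Set.univ (fun t : ℝ => f (x + t • (y - x))) := by
    have := hf.comp_affineMap (AffineMap.lineMap (k := ℝ) x y)
    simpa [Function.comp_def, AffineMap.lineMap_apply, add_comm] using this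
  have h0 : HasGradientAt f G (x + (0 : ℝ) • (y - x)) := by simpa using h
  have := hc.le_slope_of_hasDerivAt (Set.mem_univ 0) (Set.mem_univ 1) zero_lt_one
    h0.hasDerivAt_line
  simp [slope_def_field] at this
  linarith

lemma abs_sub_le_of_gradient_bound {X : Set E} (hX : Convex ℝ X) {f : E → ℝ} {f' : E → E} {B : ℝ}
    (hf : ∀ u ∈ X, HasGradientAt f (f' u) u) (hB : ∀ u ∈ X, ‖f' u‖ ≤ B) {x y : E}
    (hx : x ∈ X) (hy : y ∈ X) : |f y - f x| ≤ B * ‖y - x‖ := by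
  refine hX.norm_image_sub_le_of_norm_hasFDerivWithin_le (𝕜 := ℝ) (f := f)
    (f' := fun u => InnerProductSpace.toDual ℝ E (f' u))
    (fun u hu => (hf u hu).hasFDerivAt.hasFDerivWithinAt) (fun u hu => ?_) hx hy
  simpa using hB u hu

end Calculus

/-! ### Hessians -/

section Hessian

variable {n : ℕ} {φ : Vec n → ℝ}

lemma ContDiff.hasGradientAt (hφ : ContDiff ℝ 2 φ) (x : Vec n) :
    HasGradientAt φ (gradient φ x) x :=
  (hφ.differentiable (by norm_num) x).hasGradientAt

lemma ContDiff.contDiff_gradient (hφ : ContDiff ℝ 2 φ) : ContDiff ℝ 1 (gradient φ) :=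
  (InnerProductSpace.toDual ℝ (Vec n)).symm.contDiff.comp
    (hφ.fderiv_right (m := 1) (by norm_num))

lemma ContDiff.hasFDerivAt_gradient (hφ : ContDiff ℝ 2 φ) (x : Vec n) :
    HasFDerivAt (gradient φ) (hess φ x) x :=
  (hφ.contDiff_gradient.differentiable (by norm_num) x).hasFDerivAt

lemma ContDiff.continuous_hess (hφ : ContDiff ℝ 2 φ) : Continuous (hess φ) :=
  hφ.contDiff_gradient.continuous_fderiv (by norm_num)

lemma ContDiff.inner_hess_comm (hφ : ContDiff ℝ 2 φ) (x u v : Vec n) :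
    ⟪hess φ x u, v⟫ = ⟪u, hess φ x v⟫ := by
  have hsymm : IsSymmSndFDerivAt ℝ φ x := hφ.contDiffAt.isSymmSndFDerivAt (by simp)
  have key : ∀ u v : Vec n, ⟪hess φ x u, v⟫ = fderiv ℝ (fderiv ℝ φ) x u v := by
    intro u v
    have h1 : fderiv ℝ φ = fun y => innerSL ℝ (gradient φ y) := by
      ext y w; simp [inner_gradient_left]
    have h2 : HasFDerivAt (fderiv ℝ φ) ((innerSL ℝ).comp (hess φ x)) x := by
      rw [h1]
      exact (innerSL ℝ).hasFDerivAt.comp x (hφ.hasFDerivAt_gradient x)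
    rw [h2.fderiv]
    simp
  rw [key, real_inner_comm, key, hsymm.eq]

lemma ConvexOn.inner_hess_nonneg (hc : ConvexOn ℝ Set.univ φ) (hφ : ContDiff ℝ 2 φ)
    (x v : Vec n) : 0 ≤ ⟪v, hess φ x v⟫ := by
  have hmono : Monotone (fun t : ℝ => ⟪gradient φ (x + t • v), v⟫) := by
    intro s t hst
    rcases hst.eq_or_lt with rfl | hlt
    · exact le_rfl
    have h1 := hc.add_inner_gradient_le (hφ.hasGradientAt (x + s • v)) (x + t • v)
    have h2 := hc.add_inner_gradient_le (hφ.hasGradientAt (x + t • v)) (x + s • v)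
    have e1 : x + t • v - (x + s • v) = (t - s) • v := by module
    have e2 : x + s • v - (x + t • v) = (s - t) • v := by module
    rw [e1, inner_smul_right] at h1
    rw [e2, inner_smul_right] at h2
    show ⟪gradient φ (x + s • v), v⟫ ≤ ⟪gradient φ (x + t • v), v⟫
    by_contra! hcon
    nlinarith
  have hd : HasDerivAt (fun t : ℝ => ⟪gradient φ (x + t • v), v⟫) ⟪hess φ x v, v⟫ 0 := by
    have h1 : HasDerivAt (fun s : ℝ => x + s • v) v 0 := by
      simpa using ((hasDerivAt_id (0 : ℝ)).smul_const v).const_add x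
    have h0 : HasFDerivAt (gradient φ) (hess φ x) (x + (0 : ℝ) • v) := by
      simpa using hφ.hasFDerivAt_gradient x
    simpa using (h0.comp_hasDerivAt 0 h1).inner ℝ (hasDerivAt_const 0 v)
  have := hmono.deriv_nonneg (x := 0)
  rwa [hd.deriv, real_inner_comm] at this

end Hessian

/-! ### Variational inequalities -/

section Variational

variable {E : Type*} [NormedAddCommGroup E] [InnerProductSpace ℝ E]

lemma eq_zero_of_variational_of_mem_interior {X : Set E} {x w : E} (hx : x ∈ interior X)
    (hw : ∀ u ∈ X, 0 ≤ ⟪w, u - x⟫) : w = 0 := by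
  have hcont : Filter.Tendsto (fun t : ℝ => x - t • w) (nhdsWithin 0 (Set.Ioi 0)) (nhds x) := by
    have : Continuous (fun t : ℝ => x - t • w) := by fun_prop
    simpa using (this.tendsto 0).mono_left nhdsWithin_le_nhds
  obtain ⟨t, ht, ht0⟩ := ((hcont.eventually (mem_interior_iff_mem_nhds.1 hx)).and
    self_mem_nhdsWithin).exists
  have h1 := hw _ ht
  rw [sub_sub_cancel_left, inner_neg_right, inner_smul_right, real_inner_self_eq_norm_sq] at h1
  have h2 : ‖w‖ ^ 2 ≤ 0 := by
    by_contra! hpos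
    have := mul_pos (Set.mem_Ioi.1 ht0) hpos
    linarith
  simpa using h2

/-- First-order optimality of a proximal linear step over a convex set. -/
lemma variational_of_isMin_prox {X : Set E} (hX : Convex ℝ X) {G x p : E} {η : ℝ} (hp : p ∈ X)
    (hmin : ∀ u ∈ X, ⟪G, p⟫ + η / 2 * ‖p - x‖ ^ 2 ≤ ⟪G, u⟫ + η / 2 * ‖u - x‖ ^ 2)
    {u : E} (hu : u ∈ X) : 0 ≤ ⟪G + η • (p - x), u - p⟫ := by
  have hexp : ∀ t : ℝ, ⟪G, p + t • (u - p)⟫ + η / 2 * ‖p + t • (u - p) - x‖ ^ 2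
      = ⟪G, p⟫ + η / 2 * ‖p - x‖ ^ 2 + t * ⟪G + η • (p - x), u - p⟫
        + t ^ 2 * (η / 2 * ‖u - p‖ ^ 2) := by
    intro t
    have e : p + t • (u - p) - x = (p - x) + t • (u - p) := by module
    rw [e, norm_add_sq_real, inner_add_right, inner_smul_right, inner_smul_right, norm_smul,
      inner_add_left, inner_smul_left, mul_pow, Real.norm_eq_abs, sq_abs]
    simp
    ring
  have hpos : ∀ t ∈ Set.Ioc (0 : ℝ) 1,
      0 ≤ ⟪G + η • (p - x), u - p⟫ + t * (η / 2 * ‖u - p‖ ^ 2) := by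
    intro t ht
    have h1 := hmin _ (hX.add_smul_sub_mem hp hu ⟨ht.1.le, ht.2⟩)
    rw [hexp] at h1
    by_contra! hcon
    nlinarith [ht.1]
  have hcont : Filter.Tendsto (fun t : ℝ => ⟪G + η • (p - x), u - p⟫ + t * (η / 2 * ‖u - p‖ ^ 2))
      (nhdsWithin 0 (Set.Ioi 0)) (nhds ⟪G + η • (p - x), u - p⟫) := by
    have : Continuous (fun t : ℝ => ⟪G + η • (p - x), u - p⟫ + t * (η / 2 * ‖u - p‖ ^ 2)) := by
      fun_prop
    simpa using (this.tendsto 0).mono_left nhdsWithin_le_nhds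
  refine ge_of_tendsto hcont ?_
  filter_upwards [Ioc_mem_nhdsGT (zero_lt_one' ℝ)] with t ht using hpos t ht

end Variational

/-! ### The smallest eigenvalue of a symmetric operator -/

section Spectrum

variable {E : Type*} [NormedAddCommGroup E] [InnerProductSpace ℝ E] [FiniteDimensional ℝ E]

lemma mem_spectrum_iff_exists_eigenvector {T : E →L[ℝ] E} {μ : ℝ} :
    μ ∈ spectrum ℝ T ↔ ∃ v, v ≠ 0 ∧ T v = μ • v := by
  have : CompleteSpace E := FiniteDimensional.complete ℝ E
  rw [spectrum.mem_iff, ContinuousLinearMap.isUnit_iff_bijective]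
  have hinj : Function.Bijective (algebraMap ℝ (E →L[ℝ] E) μ - T) ↔
      Function.Injective (algebraMap ℝ (E →L[ℝ] E) μ - T : E →L[ℝ] E) :=
    ⟨fun h => h.1, fun h => ⟨h, LinearMap.injective_iff_surjective
      (f := ((algebraMap ℝ (E →L[ℝ] E) μ - T : E →L[ℝ] E) : E →ₗ[ℝ] E)).1 h⟩⟩
  rw [hinj, injective_iff_map_eq_zero]
  push Not
  refine exists_congr fun v => ?_
  rw [and_comm]
  rw [sub_apply, sub_eq_zero, eq_comm]
  simp [Algebra.algebraMap_eq_smul_one]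

lemma exists_isLeast_spectrum [Nontrivial E] {T : E →L[ℝ] E}
    (hT : ∀ u v, ⟪T u, v⟫ = ⟪u, T v⟫) :
    ∃ μ, IsLeast (spectrum ℝ T) μ ∧ (∀ v, μ * ‖v‖ ^ 2 ≤ ⟪v, T v⟫) ∧
      ∃ v, v ≠ 0 ∧ T v = μ • v := by
  have : CompleteSpace E := FiniteDimensional.complete ℝ E
  have hsymm : (T : E →ₗ[ℝ] E).IsSymmetric := hT
  have hev := hsymm.hasEigenvalue_iInf_of_finiteDimensional
  set μ : ℝ := ⨅ x : {x : E // x ≠ 0}, ⟪T x, x⟫ / ‖(x : E)‖ ^ 2 with hμ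
  have hev' : ∃ v, v ≠ 0 ∧ T v = μ • v := by
    obtain ⟨v, hv⟩ := hev.exists_hasEigenvector
    exact ⟨v, hv.2, hv.apply_eq_smul⟩
  have hbdd : BddBelow (Set.range fun x : {x : E // x ≠ 0} => ⟪T x, x⟫ / ‖(x : E)‖ ^ 2) := by
    refine ⟨-‖T‖, ?_⟩
    rintro _ ⟨x, rfl⟩
    exact (abs_le.1 (T.rayleighQuotient_le_norm x)).1
  have hbound : ∀ v, μ * ‖v‖ ^ 2 ≤ ⟪v, T v⟫ := by
    intro v
    rcases eq_or_ne v 0 with rfl | hv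
    · simp
    · have h1 := ciInf_le hbdd ⟨v, hv⟩
      have h2 : 0 < ‖v‖ ^ 2 := by positivity
      rw [real_inner_comm]
      exact (le_div_iff₀ h2).1 h1
  refine ⟨μ, ⟨mem_spectrum_iff_exists_eigenvector.2 hev', fun lam hlam => ?_⟩, hbound, hev'⟩
  obtain ⟨v, hv, hTv⟩ := mem_spectrum_iff_exists_eigenvector.1 hlam
  have h1 := hbound v
  rw [hTv, inner_smul_right, real_inner_self_eq_norm_sq] at h1
  exact le_of_mul_le_mul_right h1 (by positivity)

/-- The smallest eigenvalue of the Gram matrix `Mᵀ M`, with the bound it gives. -/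
lemma exists_isLeast_spectrum_gram {ι κ : Type*} [Fintype ι] [Fintype κ] [DecidableEq κ]
    [Nonempty κ] (M : Matrix ι κ ℝ) (hM : Function.Injective M.mulVec) :
    ∃ ν, IsLeast (spectrum ℝ (Mᵀ * M)) ν ∧ 0 < ν ∧
      ∀ v : EuclideanSpace ℝ κ,
        ν * ‖v‖ ^ 2 ≤ ‖(WithLp.toLp 2 (M *ᵥ v.ofLp) : EuclideanSpace ℝ ι)‖ ^ 2 := by
  set T := Matrix.toEuclideanCLM (n := κ) (𝕜 := ℝ) (Mᵀ * M) with hTdef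
  have hinner : ∀ u v : EuclideanSpace ℝ κ, ⟪u, T v⟫ = (M *ᵥ u.ofLp) ⬝ᵥ (M *ᵥ v.ofLp) := by
    intro u v
    rw [hTdef, Matrix.inner_toEuclideanCLM, ← Matrix.mulVec_mulVec, Matrix.dotProduct_mulVec,
      Matrix.vecMul_transpose]
  have hsq : ∀ v : EuclideanSpace ℝ κ,
      ⟪v, T v⟫ = ‖(WithLp.toLp 2 (M *ᵥ v.ofLp) : EuclideanSpace ℝ ι)‖ ^ 2 := by
    intro v
    rw [hinner, EuclideanSpace.real_norm_sq_eq]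
    simp [dotProduct, sq]
  obtain ⟨ν, hν, hbound, v, hv, hTv⟩ := exists_isLeast_spectrum (T := T) (fun u v => by
    rw [real_inner_comm, hinner, hinner, dotProduct_comm])
  rw [hTdef, AlgEquiv.spectrum_eq] at hν
  refine ⟨ν, hν, ?_, fun v => (hbound v).trans_eq (hsq v)⟩
  have h1 := hsq v
  rw [hTv, inner_smul_right, real_inner_self_eq_norm_sq] at h1
  have h2 : 0 < ‖(WithLp.toLp 2 (M *ᵥ v.ofLp) : EuclideanSpace ℝ ι)‖ ^ 2 := by
    have : (WithLp.toLp 2 (M *ᵥ v.ofLp) : EuclideanSpace ℝ ι) ≠ 0 := by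
      intro h0
      apply hv
      have h3 : M *ᵥ v.ofLp = M *ᵥ 0 := by
        rw [Matrix.mulVec_zero]; simpa using h0
      simpa using hM h3
    positivity
  rw [← h1] at h2
  exact pos_of_mul_pos_left h2 (by positivity)

end Spectrum

/-! ### The function `ψ_β` -/

lemma psi_eq {β : ℝ} (hβ : 0 < β) (u v : ℝ) :
    psi β u v = (max 0 (β * u + v) ^ 2 - v ^ 2) / (2 * β) := by
  unfold psi
  split_ifs with h
  · rw [max_eq_right h]; field_simp; ring
  · rw [max_eq_left (not_le.1 h).le]; field_simp; ring

lemma hasDerivAt_max_zero_sq (t : ℝ) : HasDerivAt (fun s : ℝ => max 0 s ^ 2) (2 * max 0 t) t := by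
  rcases lt_trichotomy t 0 with ht | rfl | ht
  · rw [max_eq_left ht.le, mul_zero]
    refine (hasDerivAt_const t (0 : ℝ)).congr_of_eventuallyEq ?_
    filter_upwards [Iio_mem_nhds ht] with s hs
    rw [max_eq_left (le_of_lt hs)]; norm_num
  · rw [max_self, mul_zero]
    rw [hasDerivAt_iff_isLittleO]
    have h1 : (fun s : ℝ => s ^ 2) =o[nhds 0] fun s : ℝ => s - 0 := by
      simpa using Asymptotics.isLittleO_pow_id (𝕜 := ℝ) (n := 2) (by norm_num)
    refine Asymptotics.IsBigO.trans_isLittleO ?_ h1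
    refine Asymptotics.IsBigO.of_bound 1 (Filter.Eventually.of_forall fun s => ?_)
    rcases le_total 0 s with hs | hs <;> simp [hs]
    positivity
  · rw [max_eq_right ht.le]
    have h2 : HasDerivAt (fun s : ℝ => s ^ 2) (2 * t) t := by simpa using hasDerivAt_pow 2 t
    refine h2.congr_of_eventuallyEq ?_
    filter_upwards [Ioi_mem_nhds ht] with s hs
    rw [max_eq_right (le_of_lt hs)]

lemma hasDerivAt_psi {β : ℝ} (hβ : 0 < β) (u v : ℝ) :
    HasDerivAt (fun u => psi β u v) (max 0 (β * u + v)) u := by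
  have h1 : HasDerivAt (fun u => β * u + v) β u := by
    simpa using ((hasDerivAt_id u).const_mul β).add_const v
  have h2 := (((hasDerivAt_max_zero_sq (β * u + v)).comp u h1).sub_const (v ^ 2)).div_const (2 * β)
  convert! h2 using 1
  · ext u; simp [psi_eq hβ]
  · field_simp

lemma psi_add_mul_le {β : ℝ} (hβ : 0 < β) (u u' v : ℝ) :
    psi β u v + max 0 (β * u + v) * (u' - u) ≤ psi β u' v := by
  rw [psi_eq hβ, psi_eq hβ, ← sub_nonneg]
  have key : 0 ≤ max 0 (β * u' + v) ^ 2 - max 0 (β * u + v) ^ 2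
      - 2 * max 0 (β * u + v) * ((β * u' + v) - (β * u + v)) := by
    generalize β * u' + v = s'
    generalize β * u + v = s
    rcases le_total 0 s with hs | hs <;> rcases le_total 0 s' with hs' | hs' <;>
      simp only [hs, hs', max_eq_left, max_eq_right] <;> nlinarith [sq_nonneg (s - s')]
  have : (max 0 (β * u' + v) ^ 2 - v ^ 2) / (2 * β) -
      ((max 0 (β * u + v) ^ 2 - v ^ 2) / (2 * β) + max 0 (β * u + v) * (u' - u)) =
      (max 0 (β * u' + v) ^ 2 - max 0 (β * u + v) ^ 2
      - 2 * max 0 (β * u + v) * ((β * u' + v) - (β * u + v))) / (2 * β) := by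
    field_simp; ring
  rw [this]
  positivity

lemma psi_le_add_mul_add {β : ℝ} (hβ : 0 < β) (u u' v : ℝ) :
    psi β u' v ≤ psi β u v + max 0 (β * u + v) * (u' - u) + β / 2 * (u' - u) ^ 2 := by
  rw [psi_eq hβ, psi_eq hβ, ← sub_nonneg]
  have key : 0 ≤ max 0 (β * u + v) ^ 2 + 2 * max 0 (β * u + v) * ((β * u' + v) - (β * u + v))
      + ((β * u' + v) - (β * u + v)) ^ 2 - max 0 (β * u' + v) ^ 2 := by
    generalize β * u' + v = s'
    generalize β * u + v = s
    rcases le_total 0 s with hs | hs <;> rcases le_total 0 s' with hs' | hs' <;>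
      simp only [hs, hs', max_eq_left, max_eq_right] <;> nlinarith [sq_nonneg (s - s')]
  have : (max 0 (β * u + v) ^ 2 - v ^ 2) / (2 * β) + max 0 (β * u + v) * (u' - u)
      + β / 2 * (u' - u) ^ 2 - (max 0 (β * u' + v) ^ 2 - v ^ 2) / (2 * β) =
      (max 0 (β * u + v) ^ 2 + 2 * max 0 (β * u + v) * ((β * u' + v) - (β * u + v))
      + ((β * u' + v) - (β * u + v)) ^ 2 - max 0 (β * u' + v) ^ 2) / (2 * β) := by
    field_simp; ring
  rw [this]
  positivity

lemma psi_nonpos {β u v : ℝ} (hβ : 0 < β) (hu : u ≤ 0) : psi β u v ≤ 0 := by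
  have h := psi_add_mul_le hβ u 0 v
  have h1 : psi β 0 v ≤ 0 := by
    rw [psi_eq hβ]
    refine div_nonpos_of_nonpos_of_nonneg ?_ (by positivity)
    rcases le_total 0 v with hv | hv <;> simp [hv]
    positivity
  have h2 : 0 ≤ max 0 (β * u + v) := le_max_left _ _
  nlinarith

/-- `ψ_β(u, v)` in terms of the multiplier increment `max (-v/β) u`. -/
lemma psi_eq_increment {β : ℝ} (hβ : 0 < β) (u v : ℝ) :
    psi β u v = v * max (-(v / β)) u + β / 2 * max (-(v / β)) u ^ 2 := by
  unfold psi
  have h : -(v / β) ≤ u ↔ 0 ≤ β * u + v := by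
    rw [neg_le_iff_add_nonneg, ← sub_nonneg (b := (0 : ℝ)), sub_zero]
    have : β * u + v = β * (u + v / β) := by field_simp
    rw [this, mul_nonneg_iff_of_pos_left hβ]
  split_ifs with h0
  · rw [max_eq_right (h.2 h0)]; ring
  · rw [max_eq_left (le_of_not_ge (fun hc => h0 (h.1 hc)))]; field_simp; ring

namespace Program

variable {n p m : ℕ} (P : Program n p m)

/-! ### First and second derivatives of the augmented Lagrangian -/

/-- The matrix `A` as a continuous linear map. -/
def lin : Vec n →L[ℝ] Vec p := (Matrix.toEuclideanLin P.A).toContinuousLinearMap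

/-- The matrix `Aᵀ` as a continuous linear map. -/
def adjLin : Vec p →L[ℝ] Vec n := (Matrix.toEuclideanLin P.Aᵀ).toContinuousLinearMap

lemma res_eq (x : Vec n) : P.res x = P.lin x - P.b := rfl

lemma adj_eq (y : Vec p) : P.adj y = P.adjLin y := rfl

lemma res_sub_res (x x' : Vec n) : P.res x - P.res x' = P.lin (x - x') := by
  simp [res_eq]

lemma inner_adjLin (y : Vec p) (x : Vec n) : ⟪P.adjLin y, x⟫ = ⟪y, P.lin x⟫ := by
  show ⟪(WithLp.toLp 2 (P.Aᵀ *ᵥ y.ofLp) : Vec n), x⟫ = ⟪y, (WithLp.toLp 2 (P.A *ᵥ x.ofLp) : Vec p)⟫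
  rw [EuclideanSpace.inner_eq_star_dotProduct, EuclideanSpace.inner_eq_star_dotProduct]
  simp only [star_trivial]
  rw [Matrix.mulVec_transpose, dotProduct_comm, ← Matrix.dotProduct_mulVec, dotProduct_comm]

lemma norm_lin_le (x : Vec n) : ‖P.lin x‖ ≤ ‖P.A‖ * ‖x‖ := Matrix.l2_opNorm_mulVec P.A x

lemma norm_adjLin_le (y : Vec p) : ‖P.adjLin y‖ ≤ ‖P.A‖ * ‖y‖ := by
  have h : ‖P.Aᵀ‖ = ‖P.A‖ := by
    rw [← Matrix.l2_opNorm_conjTranspose P.A, Matrix.conjTranspose_eq_transpose_of_trivial]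
  rw [← h]
  exact Matrix.l2_opNorm_mulVec P.Aᵀ y

lemma hasGradientAt_F {β : ℝ} (hβ : 0 < β) (hg : ContDiff ℝ 2 P.g)
    (hf : ∀ j, ContDiff ℝ 2 (P.f j)) (x : Vec n) (y : Vec p) (z : Vec m) :
    HasGradientAt (fun u => P.F β u y z)
      (gradient P.g x + P.adjLin (y + β • P.res x) +
        ∑ j, max 0 (β * P.f j x + z j) • gradient (P.f j) x) x := by
  have hres : HasFDerivAt P.res P.lin x := P.lin.hasFDerivAt.sub_const P.b
  have h1 := (hasFDerivAt_const y x).inner ℝ hres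
  have h2 := hres.norm_sq.const_mul (β / 2)
  have h3 : ∀ j ∈ Finset.univ, HasFDerivAt (fun u => psi β (P.f j u) (z j))
      (max 0 (β * P.f j x + z j) • InnerProductSpace.toDual ℝ (Vec n) (gradient (P.f j) x)) x :=
    fun j _ => (hasDerivAt_psi hβ (P.f j x) (z j)).comp_hasFDerivAt x
      ((hf j).hasGradientAt x).hasFDerivAt
  have h4 := (((hg.hasGradientAt x).hasFDerivAt.add h1).add h2).add (HasFDerivAt.fun_sum h3)
  rw [hasGradientAt_iff_hasFDerivAt]
  refine h4.congr_fderiv ?_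
  ext v
  simp [inner_adjLin]
  ring

lemma gradF_eq {β : ℝ} (hβ : 0 < β) (hg : ContDiff ℝ 2 P.g)
    (hf : ∀ j, ContDiff ℝ 2 (P.f j)) (x : Vec n) (y : Vec p) (z : Vec m) :
    P.gradF β x y z = gradient P.g x + P.adjLin (y + β • P.res x) +
        ∑ j, max 0 (β * P.f j x + z j) • gradient (P.f j) x :=
  (P.hasGradientAt_F hβ hg hf x y z).gradient

lemma hasGradientAt_gradF {β : ℝ} (hβ : 0 < β) (hg : ContDiff ℝ 2 P.g)
    (hf : ∀ j, ContDiff ℝ 2 (P.f j)) (x : Vec n) (y : Vec p) (z : Vec m) :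
    HasGradientAt (fun u => P.F β u y z) (P.gradF β x y z) x := by
  rw [P.gradF_eq hβ hg hf]; exact P.hasGradientAt_F hβ hg hf x y z

/-- The Hessian of the augmented Lagrangian where the set of indices with
`β f_j(x) + z_j > 0` is `J` and no `β f_j(x) + z_j` vanishes. -/
def hessOn (J : Finset (Fin m)) (β : ℝ) (x : Vec n) (z : Vec m) : Vec n →L[ℝ] Vec n :=
  hess P.g x + β • P.adjLin.comp P.lin +
    ∑ j ∈ J, ((β * P.f j x + z j) • hess (P.f j) x +
      β • (innerSL ℝ (gradient (P.f j) x)).smulRight (gradient (P.f j) x))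

lemma inner_hessOn (J : Finset (Fin m)) (β : ℝ) (x : Vec n) (z : Vec m) (u v : Vec n) :
    ⟪u, P.hessOn J β x z v⟫ = ⟪u, hess P.g x v⟫ + β * ⟪P.lin u, P.lin v⟫ +
      ∑ j ∈ J, ((β * P.f j x + z j) * ⟪u, hess (P.f j) x v⟫ +
        β * (⟪gradient (P.f j) x, u⟫ * ⟪gradient (P.f j) x, v⟫)) := by
  have h : ⟪u, P.adjLin (P.lin v)⟫ = ⟪P.lin u, P.lin v⟫ := by
    rw [real_inner_comm, inner_adjLin, real_inner_comm]
  simp [hessOn, inner_add_right, inner_sum, inner_smul_right, h, Finset.sum_add_distrib]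
  refine Finset.sum_congr rfl fun j _ => ?_
  ring

lemma hasFDerivAt_gradF {β : ℝ} (hβ : 0 < β) (hg : ContDiff ℝ 2 P.g)
    (hf : ∀ j, ContDiff ℝ 2 (P.f j)) {J : Finset (Fin m)} {x : Vec n} {z : Vec m}
    (hpos : ∀ j ∈ J, 0 < β * P.f j x + z j) (hneg : ∀ j ∉ J, β * P.f j x + z j < 0) (y : Vec p) :
    HasFDerivAt (fun u => P.gradF β u y z) (P.hessOn J β x z) x := by
  have hres : HasFDerivAt P.res P.lin x := P.lin.hasFDerivAt.sub_const P.b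
  have h1 := P.adjLin.hasFDerivAt.comp x ((hres.const_smul β).const_add y)
  have hcont : ∀ j, ContinuousAt (fun u => β * P.f j u + z j) x := fun j =>
    ((continuous_const.mul (hf j).continuous).add continuous_const).continuousAt
  have h2 : ∀ j ∈ J, HasFDerivAt (fun u => (β * P.f j u + z j) • gradient (P.f j) u)
      ((β * P.f j x + z j) • hess (P.f j) x +
      β • (innerSL ℝ (gradient (P.f j) x)).smulRight (gradient (P.f j) x)) x := by
    intro j _
    have h3 := (((hf j).hasGradientAt x).hasFDerivAt.const_mul β).add_const (z j)
    refine (h3.smul ((hf j).hasFDerivAt_gradient x)).congr_fderiv ?_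
    ext v
    simp
    ring
  have h4 := ((hg.hasFDerivAt_gradient x).add h1).add (HasFDerivAt.fun_sum h2)
  have h5 : ∀ᶠ u in nhds x, (∀ j ∈ J, 0 < β * P.f j u + z j) ∧ ∀ j ∉ J, β * P.f j u + z j < 0 := by
    refine Filter.Eventually.and ?_ ?_ <;> rw [Filter.eventually_all] <;> intro j <;>
      by_cases hj : j ∈ J <;> simp only [hj, not_true, not_false_iff, forall_true_left,
        IsEmpty.forall_iff, Filter.eventually_true]
    · exact (hcont j).eventually (lt_mem_nhds (hpos j hj))
    · exact (hcont j).eventually (gt_mem_nhds (hneg j hj))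
  refine (h4.congr_fderiv ?_).congr_of_eventuallyEq ?_
  · ext v; simp [hessOn]
  · filter_upwards [h5] with u hu
    rw [P.gradF_eq hβ hg hf]
    simp only [Pi.add_apply, Function.comp_apply, Pi.smul_apply]
    congr 1
    rw [← Finset.sum_subset (Finset.subset_univ J)]
    · exact Finset.sum_congr rfl fun j hj => by rw [max_eq_right (hu.1 j hj).le]
    · intro j _ hj
      rw [max_eq_left (hu.2 j hj).le, zero_smul]

lemma hessF_eq {β : ℝ} (hβ : 0 < β) (hg : ContDiff ℝ 2 P.g)
    (hf : ∀ j, ContDiff ℝ 2 (P.f j)) {J : Finset (Fin m)} {x : Vec n} {z : Vec m}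
    (hpos : ∀ j ∈ J, 0 < β * P.f j x + z j) (hneg : ∀ j ∉ J, β * P.f j x + z j < 0) (y : Vec p) :
    P.hessF β x y z = P.hessOn J β x z :=
  (P.hasFDerivAt_gradF hβ hg hf hpos hneg y).fderiv

lemma continuous_hessOn (hg : ContDiff ℝ 2 P.g) (hf : ∀ j, ContDiff ℝ 2 (P.f j))
    (J : Finset (Fin m)) (β : ℝ) :
    Continuous fun q : Vec n × Vec m => P.hessOn J β q.1 q.2 := by
  have h1 := hg.continuous_hess
  have h2 := fun j => (hf j).continuous_hess
  have h3 := fun j => (hf j).continuous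
  have h4 := fun j => (hf j).contDiff_gradient.continuous
  have h5 : ∀ j, Continuous fun q : Vec n × Vec m =>
      (innerSL ℝ (gradient (P.f j) q.1)).smulRight (gradient (P.f j) q.1) := fun j =>
    ((ContinuousLinearMap.smulRightL ℝ (Vec n) (Vec n)).continuous₂).comp
      (((innerSL ℝ).continuous.comp ((h4 j).comp continuous_fst)).prodMk
        ((h4 j).comp continuous_fst))
  have h6 : ∀ j, Continuous fun q : Vec n × Vec m => q.2 j := fun j => by fun_prop
  unfold hessOn
  refine ((h1.comp continuous_fst).add continuous_const).add (continuous_finsetSum _ fun j _ => ?_)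
  exact (((continuous_const.mul ((h3 j).comp continuous_fst)).add (h6 j)).smul
    ((h2 j).comp continuous_fst)).add ((h5 j).const_smul β)

end Program

namespace Program

variable {n p m : ℕ} (P : Program n p m)

/-! ### Convexity and descent for the augmented Lagrangian -/

/-- The regularity of the data of the problem: `h = ι_X` with `X` convex, `g` and the `f_j` convex
and `C²`, with Lipschitz gradients on `X`, those of the `f_j` being bounded there. -/
structure Regular (X : Set (Vec n)) (Lg : ℝ) (L B : Fin m → ℝ) : Prop where
  convex_X : Convex ℝ X
  h_eq : P.h = indicatorFn X
  convex_g : ConvexOn ℝ Set.univ P.g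
  convex_f : ∀ j, ConvexOn ℝ Set.univ (P.f j)
  smooth_g : ContDiff ℝ 2 P.g
  smooth_f : ∀ j, ContDiff ℝ 2 (P.f j)
  lip : P.LipData Lg L B

variable {P} {X : Set (Vec n)} {Lg : ℝ} {L B : Fin m → ℝ}

lemma Regular.effDom_eq (R : P.Regular X Lg L B) : effDom P.h = X := by
  ext x
  rw [R.h_eq]
  by_cases hx : x ∈ X <;> simp [effDom, indicatorFn, hx]

lemma Regular.lip_g (R : P.Regular X Lg L B) : ∀ x ∈ X, ∀ x' ∈ X,
    ‖gradient P.g x - gradient P.g x'‖ ≤ Lg * ‖x - x'‖ := by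
  have := R.lip.lip_g; rwa [R.effDom_eq] at this

lemma Regular.lip_f (R : P.Regular X Lg L B) (j : Fin m) : ∀ x ∈ X, ∀ x' ∈ X,
    ‖gradient (P.f j) x - gradient (P.f j) x'‖ ≤ L j * ‖x - x'‖ := by
  have := R.lip.lip_f j; rwa [R.effDom_eq] at this

lemma Regular.bound_f (R : P.Regular X Lg L B) (j : Fin m) :
    ∀ x ∈ X, ‖gradient (P.f j) x‖ ≤ B j := by
  have := R.lip.bound_f j; rwa [R.effDom_eq] at this

lemma Regular.abs_f_sub_le (R : P.Regular X Lg L B) (j : Fin m) {x x' : Vec n} (hx : x ∈ X)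
    (hx' : x' ∈ X) : |P.f j x' - P.f j x| ≤ B j * ‖x' - x‖ :=
  abs_sub_le_of_gradient_bound R.convex_X (fun u _ => (R.smooth_f j).hasGradientAt u)
    (R.bound_f j) hx hx'

lemma res_quadratic_expansion (P : Program n p m) (β : ℝ) (x x' : Vec n) (y : Vec p) :
    ⟪y, P.res x'⟫ + β / 2 * ‖P.res x'‖ ^ 2 = ⟪y, P.res x⟫ + β / 2 * ‖P.res x‖ ^ 2
      + ⟪P.adjLin (y + β • P.res x), x' - x⟫ + β / 2 * ‖P.lin (x' - x)‖ ^ 2 := by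
  have h : P.res x' = P.res x + P.lin (x' - x) := by rw [← res_sub_res]; abel
  rw [inner_adjLin, h, norm_add_sq_real, inner_add_right, inner_add_left, inner_smul_left]
  simp
  ring

/-- The descent inequality for `F_β(·, y, z)`. The constant depends on the base point `x` because
`∂_u ψ_β` is `β`-Lipschitz, so only its value at `x` multiplies the curvature of the `f_j`. -/
lemma Regular.F_le (R : P.Regular X Lg L B) {β : ℝ} (hβ : 0 < β) {x x' : Vec n} (hx : x ∈ X)
    (hx' : x' ∈ X) (y : Vec p) (z : Vec m) :
    P.F β x' y z ≤ P.F β x y z + ⟪P.gradF β x y z, x' - x⟫ +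
      P.LF β Lg L B x z / 2 * ‖x' - x‖ ^ 2 := by
  have h1 := le_add_inner_of_lipschitz_gradient R.convex_X
    (fun u _ => R.smooth_g.hasGradientAt u) R.lip_g hx hx'
  have h2 := P.res_quadratic_expansion β x x' y
  have h3 : ‖P.lin (x' - x)‖ ^ 2 ≤ ‖P.A‖ ^ 2 * ‖x' - x‖ ^ 2 := by
    rw [← mul_pow]
    exact pow_le_pow_left₀ (norm_nonneg _) (P.norm_lin_le _) 2
  have h4 : ∀ j ∈ Finset.univ, psi β (P.f j x') (z j) ≤ psi β (P.f j x) (z j)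
      + max 0 (β * P.f j x + z j) * ⟪gradient (P.f j) x, x' - x⟫
      + (β * B j ^ 2 + L j * max 0 (β * P.f j x + z j)) * (‖x' - x‖ ^ 2 / 2) := by
    intro j _
    have a1 := psi_le_add_mul_add hβ (P.f j x) (P.f j x') (z j)
    have a2 := le_add_inner_of_lipschitz_gradient R.convex_X
      (fun u _ => (R.smooth_f j).hasGradientAt u) (R.lip_f j) hx hx'
    have a3 : (P.f j x' - P.f j x) ^ 2 ≤ B j ^ 2 * ‖x' - x‖ ^ 2 := by
      rw [← mul_pow, ← sq_abs]
      exact pow_le_pow_left₀ (abs_nonneg _) (R.abs_f_sub_le j hx hx') 2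
    have a4 : max 0 (β * P.f j x + z j) * (P.f j x' - P.f j x) ≤ max 0 (β * P.f j x + z j) *
        (⟪gradient (P.f j) x, x' - x⟫ + L j / 2 * ‖x' - x‖ ^ 2) :=
      mul_le_mul_of_nonneg_left (by linarith) (le_max_left _ _)
    have a5 := mul_le_mul_of_nonneg_left a3 hβ.le
    linarith
  have h5 := Finset.sum_le_sum h4
  rw [Finset.sum_add_distrib, Finset.sum_add_distrib, ← Finset.sum_mul] at h5
  rw [P.gradF_eq hβ R.smooth_g R.smooth_f, inner_add_left, inner_add_left, sum_inner]
  simp only [inner_smul_left, conj_trivial]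
  unfold F LF
  have h6 := mul_le_mul_of_nonneg_left h3 hβ.le
  linarith

/-- Convexity of `F_β(·, y, z)`, keeping the exact convexity gap of the quadratic penalty. -/
lemma Regular.le_F (R : P.Regular X Lg L B) {β : ℝ} (hβ : 0 < β) (x x' : Vec n)
    (y : Vec p) (z : Vec m) :
    P.F β x y z + ⟪P.gradF β x y z, x' - x⟫ + β / 2 * ‖P.lin (x' - x)‖ ^ 2 ≤ P.F β x' y z := by
  have h1 := R.convex_g.add_inner_gradient_le (R.smooth_g.hasGradientAt x) x'
  have h2 := P.res_quadratic_expansion β x x' y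
  have h4 : ∀ j ∈ Finset.univ, psi β (P.f j x) (z j)
      + max 0 (β * P.f j x + z j) * ⟪gradient (P.f j) x, x' - x⟫ ≤ psi β (P.f j x') (z j) := by
    intro j _
    have a1 := psi_add_mul_le hβ (P.f j x) (P.f j x') (z j)
    have a2 := (R.convex_f j).add_inner_gradient_le ((R.smooth_f j).hasGradientAt x) x'
    have a4 : max 0 (β * P.f j x + z j) * ⟪gradient (P.f j) x, x' - x⟫ ≤
        max 0 (β * P.f j x + z j) * (P.f j x' - P.f j x) :=
      mul_le_mul_of_nonneg_left (by linarith) (le_max_left _ _)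
    linarith
  have h5 := Finset.sum_le_sum h4
  rw [Finset.sum_add_distrib] at h5
  rw [P.gradF_eq hβ R.smooth_g R.smooth_f, inner_add_left, inner_add_left, sum_inner]
  simp only [inner_smul_left, conj_trivial]
  unfold F
  linarith

/-! ### Consequences of the KKT conditions -/

variable {xs : Vec n} {ys : Vec p} {zs : Vec m}

lemma IsKKT.stationary_of_mem_interior (hK : P.IsKKT xs ys zs) (hh : P.h = indicatorFn X)
    (hxs : xs ∈ interior X) :
    gradient P.g xs + P.adjLin ys + ∑ j, zs j • gradient (P.f j) xs = 0 := by
  obtain ⟨v, hv, hsum⟩ := hK.stationary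
  have hv0 : -v = 0 := by
    refine eq_zero_of_variational_of_mem_interior hxs fun u hu => ?_
    have h1 := hv.2 u
    rw [hh] at h1
    simp only [indicatorFn, hu, interior_subset hxs, if_true, zero_add] at h1
    rw [inner_neg_left]
    have h2 : ⟪v, u - xs⟫ ≤ 0 := by exact_mod_cast h1
    linarith
  rw [neg_eq_zero] at hv0
  rw [hv0, add_zero, adj_eq] at hsum
  exact hsum

/-- A KKT point interior to `X` minimizes the Lagrangian over the whole space. -/
lemma IsKKT.g_le_lagrangian (hK : P.IsKKT xs ys zs) (R : P.Regular X Lg L B)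
    (hxs : xs ∈ interior X) (u : Vec n) :
    P.g xs ≤ P.g u + ⟪ys, P.res u⟫ + ∑ j, zs j * P.f j u := by
  have h1 := R.convex_g.add_inner_gradient_le (R.smooth_g.hasGradientAt xs) u
  have h2 : ∀ j ∈ Finset.univ, zs j * ⟪gradient (P.f j) xs, u - xs⟫ ≤ zs j * P.f j u := by
    intro j _
    have a := (R.convex_f j).add_inner_gradient_le ((R.smooth_f j).hasGradientAt xs) u
    have b := mul_le_mul_of_nonneg_left a (hK.multiplier_nonneg j)
    have c := hK.complementary j
    linarith
  have h3 := Finset.sum_le_sum h2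
  have h4 := congrArg (fun w => ⟪w, u - xs⟫) (hK.stationary_of_mem_interior R.h_eq hxs)
  simp only [inner_add_left, sum_inner, inner_smul_left, conj_trivial, inner_zero_left,
    inner_adjLin] at h4
  rw [← P.res_sub_res, hK.eq_constr, sub_zero] at h4
  linarith

/-- By complementarity, `[β f_j(x*) + z*_j]_+ = z*_j`. -/
lemma IsKKT.max_eq (hK : P.IsKKT xs ys zs) {β : ℝ} (hβ : 0 < β) (j : Fin m) :
    max 0 (β * P.f j xs + zs j) = zs j := by
  rcases mul_eq_zero.1 (hK.complementary j) with h | h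
  · rw [h, add_zero]
    exact max_eq_left (mul_nonpos_of_nonneg_of_nonpos hβ.le (hK.ineq_constr j))
  · rw [h, mul_zero, zero_add]
    exact max_eq_right (hK.multiplier_nonneg j)

lemma IsKKT.gradF_eq_zero (hK : P.IsKKT xs ys zs) (R : P.Regular X Lg L B)
    (hxs : xs ∈ interior X) {β : ℝ} (hβ : 0 < β) : P.gradF β xs ys zs = 0 := by
  rw [P.gradF_eq hβ R.smooth_g R.smooth_f, hK.eq_constr, smul_zero, add_zero]
  simp only [hK.max_eq hβ]
  exact hK.stationary_of_mem_interior R.h_eq hxs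

lemma IsKKT.F_eq (hK : P.IsKKT xs ys zs) {β : ℝ} (hβ : 0 < β) : P.F β xs ys zs = P.g xs := by
  have h : ∀ j, psi β (P.f j xs) (zs j) = 0 := fun j => by
    rw [psi_eq hβ, hK.max_eq hβ, sub_self, zero_div]
  simp [F, hK.eq_constr, h]

/-! ### One step of the method -/

/-- The increment `max (-z_j/β, f_j(x⁺))` of the multiplier `z_j`, divided by the dual step. -/
def incr (P : Program n p m) (β : ℝ) (x' : Vec n) (z : Vec m) (j : Fin m) : ℝ :=
  max (-(z j / β)) (P.f j x')

/-- What a step gains from the new primal point `x'`: half of it is a Lagrangian gap, half of it an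
augmented Lagrangian gap at the optimal multipliers. -/
def stepGain (P : Program n p m) (β : ℝ) (xs : Vec n) (ys : Vec p) (zs : Vec m) (x' : Vec n)
    (z : Vec m) : ℝ :=
  P.g x' - P.g xs + ⟪ys, P.res x'⟫ + β / 4 * ‖P.res x'‖ ^ 2 +
    ∑ j, (zs j * P.incr β x' z j + β / 4 * P.incr β x' z j ^ 2)

lemma IsKKT.stepGain_nonneg (hK : P.IsKKT xs ys zs) (R : P.Regular X Lg L B)
    (hxs : xs ∈ interior X) {β : ℝ} (hβ : 0 < β) (x' : Vec n) (z : Vec m) :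
    0 ≤ P.stepGain β xs ys zs x' z := by
  have h1 := hK.g_le_lagrangian R hxs x'
  have h2 : ∑ j, zs j * P.f j x' ≤
      ∑ j, (zs j * P.incr β x' z j + β / 4 * P.incr β x' z j ^ 2) := by
    refine Finset.sum_le_sum fun j _ => ?_
    have := mul_le_mul_of_nonneg_left (le_max_right (-(z j / β)) (P.f j x'))
      (hK.multiplier_nonneg j)
    have h3 : 0 ≤ β / 4 * P.incr β x' z j ^ 2 := by positivity
    unfold incr at h3 ⊢
    linarith
  have h3 : 0 ≤ β / 4 * ‖P.res x'‖ ^ 2 := by positivity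
  unfold stepGain
  linarith

/-- The basic inequality of the method. The dual terms telescope because, with dual step `β / 2`,
the squared distances of the multipliers reproduce half of the penalty terms of `F_β`. -/
lemma IsKKT.step_le (hK : P.IsKKT xs ys zs) (R : P.Regular X Lg L B)
    (hxs : xs ∈ interior X) {β δ η : ℝ} (hβ : 0 < β) {x x' : Vec n} {y y' : Vec p}
    {z z' : Vec m} (hx : x ∈ X) (hx' : x' ∈ X)
    (hη : P.LF β Lg L B x z + δ ≤ η)
    (hvar : ∀ u ∈ X, 0 ≤ ⟪P.gradF β x y z + η • (x' - x), u - x'⟫)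
    (hy : y' = y + (β / 2) • P.res x') (hz : ∀ j, z' j = z j + β / 2 * P.incr β x' z j) :
    η / 2 * ‖x' - xs‖ ^ 2 + 1 / β * (‖y' - ys‖ ^ 2 + ‖z' - zs‖ ^ 2) + δ / 2 * ‖x' - x‖ ^ 2
      + β / 2 * ‖P.lin (x - xs)‖ ^ 2 + P.stepGain β xs ys zs x' z
      ≤ η / 2 * ‖x - xs‖ ^ 2 + 1 / β * (‖y - ys‖ ^ 2 + ‖z - zs‖ ^ 2) := by
  have h1 := R.F_le hβ hx hx' y z
  have h2 := R.le_F hβ x xs y z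
  have h3 := hvar xs (interior_subset hxs)
  have h4 : P.F β xs y z ≤ P.g xs := by
    have : ∑ j, psi β (P.f j xs) (z j) ≤ 0 :=
      Finset.sum_nonpos fun j _ => psi_nonpos hβ (hK.ineq_constr j)
    simp only [F, hK.eq_constr, inner_zero_right, norm_zero]
    linarith
  -- the three-point identity for the proximal term
  have h5 : ⟪η • (x' - x), xs - x'⟫ = η / 2 * (‖x - xs‖ ^ 2 - ‖x' - xs‖ ^ 2 - ‖x' - x‖ ^ 2) := by
    have e : x - xs = (x' - xs) - (x' - x) := by abel
    have e2 : xs - x' = -(x' - xs) := by abel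
    rw [e, norm_sub_sq_real, e2, inner_neg_right, inner_smul_left, real_inner_comm]
    simp
    ring
  have h6 : ‖P.lin (xs - x)‖ = ‖P.lin (x - xs)‖ := by
    rw [← neg_sub x xs, map_neg, norm_neg]
  have h7 : ‖y' - ys‖ ^ 2 = ‖y - ys‖ ^ 2 + β * ⟪y - ys, P.res x'⟫ + β ^ 2 / 4 * ‖P.res x'‖ ^ 2 := by
    have e : y' - ys = (y - ys) + (β / 2) • P.res x' := by rw [hy]; abel
    rw [e, norm_add_sq_real, inner_smul_right, norm_smul, mul_pow, Real.norm_eq_abs, sq_abs]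
    ring
  have h8 : ‖z' - zs‖ ^ 2 = ‖z - zs‖ ^ 2 + ∑ j, (β * ((z j - zs j) * P.incr β x' z j)
      + β ^ 2 / 4 * P.incr β x' z j ^ 2) := by
    rw [EuclideanSpace.real_norm_sq_eq, EuclideanSpace.real_norm_sq_eq, ← Finset.sum_add_distrib]
    refine Finset.sum_congr rfl fun j _ => ?_
    simp only [PiLp.sub_apply, hz]
    ring
  have h9 : P.F β x' y z = P.g x' + ⟪y, P.res x'⟫ + β / 2 * ‖P.res x'‖ ^ 2 +
      ∑ j, (z j * P.incr β x' z j + β / 2 * P.incr β x' z j ^ 2) := by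
    unfold F incr
    simp only [psi_eq_increment hβ]
  have h10 : 1 / β * (‖y' - ys‖ ^ 2 + ‖z' - zs‖ ^ 2) = 1 / β * (‖y - ys‖ ^ 2 + ‖z - zs‖ ^ 2) +
      (P.F β x' y z - P.g xs - P.stepGain β xs ys zs x' z) := by
    have e : ∑ j, (β * ((z j - zs j) * P.incr β x' z j) + β ^ 2 / 4 * P.incr β x' z j ^ 2) =
        β * (∑ j, (z j * P.incr β x' z j + β / 2 * P.incr β x' z j ^ 2) -
          ∑ j, (zs j * P.incr β x' z j + β / 4 * P.incr β x' z j ^ 2)) := by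
      rw [← Finset.sum_sub_distrib, Finset.mul_sum]
      exact Finset.sum_congr rfl fun j _ => by ring
    rw [h7, h8, e, h9, inner_sub_left]
    unfold stepGain
    generalize ∑ j, (z j * P.incr β x' z j + β / 2 * P.incr β x' z j ^ 2) = s
    generalize ∑ j, (zs j * P.incr β x' z j + β / 4 * P.incr β x' z j ^ 2) = s'
    field_simp
    ring
  have h11 : (P.LF β Lg L B x z + δ) / 2 * ‖x' - x‖ ^ 2 ≤ η / 2 * ‖x' - x‖ ^ 2 := by gcongr
  have h12 : ⟪P.gradF β x y z, x' - x⟫ =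
      ⟪P.gradF β x y z, xs - x⟫ - ⟪P.gradF β x y z, xs - x'⟫ := by
    rw [← inner_sub_right]; congr 1; abel
  rw [inner_add_left, h5] at h3
  rw [h6] at h2
  rw [h10]
  linarith

/-- Near the KKT point the gain of a step controls the primal error, through the Hessian of the
augmented Lagrangian, and the inactive multipliers, which the dual step shrinks. -/
lemma IsKKT.le_stepGain (hK : P.IsKKT xs ys zs) (R : P.Regular X Lg L B)
    (hxs : xs ∈ interior X) {β μ γ : ℝ} (hβ : 0 < β) {J : Finset (Fin m)}
    (hJ : ∀ j ∉ J, zs j = 0)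
    (hγ : P.AdmissibleRadius X J β μ L xs ys zs γ) {x' : Vec n} {z : Vec m}
    (hx' : ‖x' - xs‖ ≤ γ) (hz : ‖z - zs‖ ≤ γ) :
    μ / 8 * ‖x' - xs‖ ^ 2 + ∑ j ∈ Jᶜ, z j ^ 2 / (4 * β) ≤ P.stepGain β xs ys zs x' z := by
  have hz0 : ‖zs - zs‖ ≤ γ := by simpa using hγ.pos.le
  have hy0 : ‖ys - ys‖ ≤ γ := by simpa using hγ.pos.le
  have hseg : ∀ t ∈ Set.Icc (0 : ℝ) 1, ‖xs + t • (x' - xs) - xs‖ ≤ γ := fun t ht => by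
    rw [add_sub_cancel_left, norm_smul, Real.norm_of_nonneg ht.1]
    exact (mul_le_of_le_one_left (norm_nonneg _) ht.2).trans hx'
  have h1 := add_inner_add_le_of_hessian_ge (f := fun u => P.F β u ys zs)
    (f' := fun u => P.gradF β u ys zs) (H := fun u => P.hessOn J β u zs) (m := μ / 2)
    (x := xs) (y := x')
    (fun t _ => P.hasGradientAt_gradF hβ R.smooth_g R.smooth_f _ ys zs)
    (fun t ht => P.hasFDerivAt_gradF hβ R.smooth_g R.smooth_f
      (hγ.sign_pos _ _ (hseg t ht) hz0) (hγ.sign_neg _ _ (hseg t ht) hz0) ys)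
    (fun t ht => by
      rw [← P.hessF_eq hβ R.smooth_g R.smooth_f
        (hγ.sign_pos _ _ (hseg t ht) hz0) (hγ.sign_neg _ _ (hseg t ht) hz0) ys]
      exact hγ.hessian _ ys zs (hseg t ht) hy0 hz0 _)
  simp only [hK.gradF_eq_zero R hxs hβ, inner_zero_left, hK.F_eq hβ] at h1
  have h2 := hK.g_le_lagrangian R hxs x'
  have hsplit : ∀ c : Fin m → ℝ, ∑ j, c j = ∑ j ∈ J, c j + ∑ j ∈ Jᶜ, c j := fun c =>
    (Finset.sum_add_sum_compl J c).symm
  have h3 : ∑ j, psi β (P.f j x') (zs j) = ∑ j ∈ J, (zs j * P.f j x' + β / 2 * P.f j x' ^ 2) := by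
    rw [hsplit, Finset.sum_eq_zero (s := Jᶜ), add_zero]
    · refine Finset.sum_congr rfl fun j hj => ?_
      rw [psi, if_pos (hγ.sign_pos _ _ hx' hz0 j hj).le]
      ring
    · intro j hj
      rw [Finset.mem_compl] at hj
      rw [psi, if_neg (not_le.2 (hγ.sign_neg _ _ hx' hz0 j hj)), hJ j hj]
      simp
  have h4 : ∑ j, zs j * P.f j x' = ∑ j ∈ J, zs j * P.f j x' := by
    rw [hsplit, Finset.sum_eq_zero (s := Jᶜ), add_zero]
    intro j hj
    rw [hJ j (Finset.mem_compl.1 hj), zero_mul]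
  have h5 : ∑ j, (zs j * P.incr β x' z j + β / 4 * P.incr β x' z j ^ 2) =
      ∑ j ∈ J, (zs j * P.f j x' + β / 4 * P.f j x' ^ 2) + ∑ j ∈ Jᶜ, z j ^ 2 / (4 * β) := by
    have e : ∀ j, β * (P.f j x' + z j / β) = β * P.f j x' + z j := fun j => by field_simp
    rw [hsplit]
    congr 1
    · refine Finset.sum_congr rfl fun j hj => ?_
      have h6 := hγ.sign_pos _ _ hx' hz j hj
      have : P.incr β x' z j = P.f j x' := by
        refine max_eq_right ?_
        rw [← e] at h6
        linarith [pos_of_mul_pos_right h6 hβ.le]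
      rw [this]
    · refine Finset.sum_congr rfl fun j hj => ?_
      have h6 := hγ.sign_neg _ _ hx' hz j (Finset.mem_compl.1 hj)
      have : P.incr β x' z j = -(z j / β) := by
        refine max_eq_left ?_
        rw [← e] at h6
        linarith [neg_of_mul_neg_right h6 hβ.le]
      rw [this, hJ j (Finset.mem_compl.1 hj)]
      field_simp
      ring
  have h7 : ∑ j ∈ J, (zs j * P.f j x' + β / 4 * P.f j x' ^ 2) =
      1 / 2 * ∑ j ∈ J, zs j * P.f j x' +
        1 / 2 * ∑ j ∈ J, (zs j * P.f j x' + β / 2 * P.f j x' ^ 2) := by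
    rw [Finset.mul_sum, Finset.mul_sum, ← Finset.sum_add_distrib]
    exact Finset.sum_congr rfl fun j _ => by ring
  unfold stepGain
  rw [h5, h7]
  unfold F at h1
  rw [h3] at h1
  rw [h4] at h2
  linarith

end Program

/-! ### The constraint Jacobian and the dual error bound -/

lemma norm_sum_sq_le {ι E : Type*} [NormedAddCommGroup E] (s : Finset ι) (a : ι → E) :
    ‖∑ i ∈ s, a i‖ ^ 2 ≤ s.card * ∑ i ∈ s, ‖a i‖ ^ 2 :=
  (pow_le_pow_left₀ (norm_nonneg _) (norm_sum_le _ _) 2).trans sq_sum_le_card_mul_sum_sq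

lemma norm_add_four_sq_le {E : Type*} [NormedAddCommGroup E] (a b c d : E) :
    ‖a + b + c + d‖ ^ 2 ≤ 4 * (‖a‖ ^ 2 + ‖b‖ ^ 2 + ‖c‖ ^ 2 + ‖d‖ ^ 2) := by
  have := norm_sum_sq_le Finset.univ ![a, b, c, d]
  simpa [Fin.sum_univ_four] using this

lemma exists_mem_ne_of_mem_interior {n : ℕ} [Nontrivial (Vec n)] {X : Set (Vec n)} {x : Vec n}
    (hx : x ∈ interior X) : ∃ u ∈ X, u ≠ x := by
  have h : X ∩ {x}ᶜ ∈ nhdsWithin x {x}ᶜ :=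
    Filter.inter_mem (mem_nhdsWithin_of_mem_nhds (mem_interior_iff_mem_nhds.1 hx))
      self_mem_nhdsWithin
  obtain ⟨u, hu, hne⟩ := Filter.nonempty_of_mem h
  exact ⟨u, hu, hne⟩

namespace Program

variable {n p m : ℕ} {P : Program n p m} {X : Set (Vec n)} {Lg : ℝ} {L B : Fin m → ℝ}
variable {xs : Vec n} {ys : Vec p} {zs : Vec m}

lemma toLp_D_mulVec (K : Finset (Fin m)) (x : Vec n) (y : Vec p) (w : Fin m → ℝ) :
    (WithLp.toLp 2 (P.D K x *ᵥ Sum.elim y.ofLp (fun j : K => w j)) : Vec n) =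
      P.adjLin y + ∑ j ∈ K, w j • gradient (P.f j) x := by
  rw [D, Matrix.fromCols_mulVec_sumElim, WithLp.toLp_add]
  congr 1
  ext i
  rw [← Finset.sum_coe_sort K]
  simp [Matrix.mulVec, dotProduct, mul_comm]

/-- The lower bound that an eigenvalue bound on `Dᵀ D` gives for combinations of constraint
gradients. -/
lemma gram_bound {K : Finset (Fin m)} {x : Vec n} {ν : ℝ}
    (hν : ∀ v : EuclideanSpace ℝ (Fin p ⊕ K),
      ν * ‖v‖ ^ 2 ≤ ‖(WithLp.toLp 2 (P.D K x *ᵥ v.ofLp) : Vec n)‖ ^ 2) (y : Vec p)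
    (w : Fin m → ℝ) :
    ν * (‖y‖ ^ 2 + ∑ j ∈ K, w j ^ 2) ≤
      ‖P.adjLin y + ∑ j ∈ K, w j • gradient (P.f j) x‖ ^ 2 := by
  have h := hν (WithLp.toLp 2 (Sum.elim y.ofLp (fun j : K => w j)))
  rw [toLp_D_mulVec, EuclideanSpace.real_norm_sq_eq, Fintype.sum_sum_type] at h
  rw [EuclideanSpace.real_norm_sq_eq, ← Finset.sum_coe_sort K]
  exact h

lemma D_mulVec_injective {K : Finset (Fin m)} {x : Vec n} (h : (P.D K x).rank = p + K.card) :
    Function.Injective (P.D K x).mulVec := by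
  have h1 := LinearMap.finrank_range_add_finrank_ker (P.D K x).mulVecLin
  have h2 : Module.finrank ℝ (P.D K x).mulVecLin.range = p + K.card := h
  rw [h2, Module.finrank_fintype_fun_eq_card] at h1
  simp only [Fintype.card_sum, Fintype.card_fin, Fintype.card_coe, Nat.add_eq_left] at h1
  exact LinearMap.ker_eq_bot.1 (Submodule.finrank_eq_zero.1 h1)

lemma Regular.B_nonneg (R : P.Regular X Lg L B) (hxs : xs ∈ X) (j : Fin m) : 0 ≤ B j :=
  (norm_nonneg _).trans (R.bound_f j xs hxs)

lemma Regular.Lg_nonneg [Nontrivial (Vec n)] (R : P.Regular X Lg L B) (hxs : xs ∈ interior X) :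
    0 ≤ Lg := by
  obtain ⟨x, hx, hne⟩ := exists_mem_ne_of_mem_interior hxs
  have h := (norm_nonneg _).trans (R.lip_g x hx xs (interior_subset hxs))
  exact nonneg_of_mul_nonneg_left h (norm_pos_iff.2 (sub_ne_zero.2 hne))

lemma Regular.L_nonneg [Nontrivial (Vec n)] (R : P.Regular X Lg L B) (hxs : xs ∈ interior X)
    (j : Fin m) : 0 ≤ L j := by
  obtain ⟨x, hx, hne⟩ := exists_mem_ne_of_mem_interior hxs
  have h := (norm_nonneg _).trans (R.lip_f j x hx xs (interior_subset hxs))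
  exact nonneg_of_mul_nonneg_left h (norm_pos_iff.2 (sub_ne_zero.2 hne))

/-- Testing the eigenvalue bound on a single column of `D`. -/
lemma mul_le_etaLow [Nontrivial (Vec n)] (R : P.Regular X Lg L B) (hxs : xs ∈ interior X)
    {K : Finset (Fin m)} (hcol : 0 < p + K.card) {β ν : ℝ} (hβ : 0 < β)
    (hν : ∀ v : EuclideanSpace ℝ (Fin p ⊕ K),
      ν * ‖v‖ ^ 2 ≤ ‖(WithLp.toLp 2 (P.D K xs *ᵥ v.ofLp) : Vec n)‖ ^ 2) :
    β * ν ≤ P.etaLow β Lg B := by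
  have hLg := R.Lg_nonneg hxs
  have hA : 0 ≤ β * ‖P.A‖ ^ 2 := by positivity
  have hB : ∀ j ∈ Finset.univ, 0 ≤ β * B j ^ 2 := fun j _ => by positivity
  have hsum := Finset.sum_nonneg hB
  unfold etaLow
  rcases Nat.eq_zero_or_pos p with hp | hp
  · obtain ⟨j, hj⟩ := Finset.card_pos.1 (show 0 < K.card by omega)
    have h := gram_bound hν 0 (Pi.single j 1)
    have h1 : ∑ i ∈ K, (Pi.single j (1 : ℝ) : Fin m → ℝ) i ^ 2 = 1 := by
      rw [Finset.sum_eq_single_of_mem j hj fun i _ hi => by simp [hi]]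
      simp
    have h2 : ∑ i ∈ K, (Pi.single j (1 : ℝ) : Fin m → ℝ) i • gradient (P.f i) xs =
        gradient (P.f j) xs := by
      rw [Finset.sum_eq_single_of_mem j hj fun i _ hi => by simp [hi]]
      simp
    rw [h1, h2, map_zero, norm_zero, zero_add] at h
    have h3 : ‖gradient (P.f j) xs‖ ^ 2 ≤ B j ^ 2 :=
      pow_le_pow_left₀ (norm_nonneg _) (R.bound_f j xs (interior_subset hxs)) 2
    have h4 : β * ν ≤ β * B j ^ 2 := mul_le_mul_of_nonneg_left (by linarith) hβ.le
    have h5 := Finset.single_le_sum hB (Finset.mem_univ j)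
    linarith
  · have h := gram_bound hν (EuclideanSpace.single ⟨0, hp⟩ 1) 0
    simp only [Pi.zero_apply, zero_smul, Finset.sum_const_zero, add_zero] at h
    have h1 := P.norm_adjLin_le (EuclideanSpace.single ⟨0, hp⟩ 1)
    have h2 : ‖(EuclideanSpace.single ⟨0, hp⟩ 1 : Vec p)‖ = 1 := by simp
    rw [h2] at h h1
    have h3 := pow_le_pow_left₀ (norm_nonneg _) h1 2
    have h4 : β * ν ≤ β * ‖P.A‖ ^ 2 :=
      mul_le_mul_of_nonneg_left (by norm_num at h h3; linarith) hβ.le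
    linarith

/-- The variation of the active constraint terms of `∇_x F_β` at a fixed multiplier. -/
lemma norm_active_sum_sq_le [Nontrivial (Vec n)] (R : P.Regular X Lg L B)
    (hxs : xs ∈ interior X) {β γ : ℝ} (hβ : 0 < β) {J : Finset (Fin m)}
    (hJ : ∀ j ∈ J, P.f j xs = 0) {x : Vec n} {z : Vec m} (hx : x ∈ X) (hz : ‖z - zs‖ ≤ γ) :
    Lg ^ 2 * ‖x - xs‖ ^ 2 + ‖∑ j ∈ J, ((β * P.f j x) • gradient (P.f j) x +
      z j • (gradient (P.f j) x - gradient (P.f j) xs))‖ ^ 2 ≤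
      rateConst J β Lg L B ‖zs‖ γ * ‖x - xs‖ ^ 2 := by
  have hxs' := interior_subset hxs
  have hterm : ∀ j ∈ J, ‖(β * P.f j x) • gradient (P.f j) x +
      z j • (gradient (P.f j) x - gradient (P.f j) xs)‖ ^ 2 ≤
      (2 * ‖x - xs‖ ^ 2) * (β ^ 2 * B j ^ 4 + (⨆ j, L j) ^ 2 * z j ^ 2) := by
    intro j hj
    have hB := R.B_nonneg hxs' j
    have hL : L j ≤ ⨆ j, L j := le_ciSup (Set.finite_range L).bddAbove j
    have h1 : ‖(β * P.f j x) • gradient (P.f j) x‖ ≤ β * B j ^ 2 * ‖x - xs‖ := by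
      have a := R.abs_f_sub_le j hxs' hx
      rw [hJ j hj, sub_zero] at a
      rw [norm_smul, Real.norm_eq_abs, abs_mul, abs_of_pos hβ]
      calc β * |P.f j x| * ‖gradient (P.f j) x‖ ≤ β * (B j * ‖x - xs‖) * B j := by
            gcongr
            exact R.bound_f j x hx
        _ = _ := by ring
    have h2 : ‖z j • (gradient (P.f j) x - gradient (P.f j) xs)‖ ≤
        |z j| * ((⨆ j, L j) * ‖x - xs‖) := by
      rw [norm_smul, Real.norm_eq_abs]
      gcongr
      exact (R.lip_f j x hx xs hxs').trans (by gcongr)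
    have h3 := (norm_add_le _ _).trans (add_le_add h1 h2)
    refine (pow_le_pow_left₀ (norm_nonneg _) h3 2).trans (add_sq_le.trans_eq ?_)
    rw [mul_pow |z j|, sq_abs]
    ring
  have h1 := (norm_sum_sq_le J _).trans
    (mul_le_mul_of_nonneg_left (Finset.sum_le_sum hterm) (Nat.cast_nonneg _))
  have hsum : ∑ j ∈ J, (β ^ 2 * B j ^ 4 + (⨆ j, L j) ^ 2 * z j ^ 2) =
      ∑ j ∈ J, β ^ 2 * B j ^ 4 + (⨆ j, L j) ^ 2 * ∑ j ∈ J, z j ^ 2 := by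
    rw [Finset.sum_add_distrib, Finset.mul_sum J (fun j => z j ^ 2)]
  rw [← Finset.mul_sum, hsum] at h1
  have h2 : ∑ j ∈ J, z j ^ 2 ≤ 2 * (‖zs‖ ^ 2 + γ ^ 2) := by
    have a : ∑ j ∈ J, z j ^ 2 ≤ ‖z‖ ^ 2 := by
      rw [EuclideanSpace.real_norm_sq_eq]
      exact Finset.sum_le_sum_of_subset_of_nonneg (Finset.subset_univ J) fun j _ _ => sq_nonneg _
    have b : ‖z‖ ≤ ‖zs‖ + γ := by
      have := norm_add_le zs (z - zs)
      rw [add_sub_cancel] at this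
      linarith
    exact a.trans ((pow_le_pow_left₀ (norm_nonneg _) b 2).trans add_sq_le)
  have h3 : (J.card : ℝ) * (2 * ‖x - xs‖ ^ 2 *
      (∑ j ∈ J, β ^ 2 * B j ^ 4 + (⨆ j, L j) ^ 2 * ∑ j ∈ J, z j ^ 2)) ≤
      (J.card : ℝ) * (2 * ‖x - xs‖ ^ 2 *
      (∑ j ∈ J, β ^ 2 * B j ^ 4 + (⨆ j, L j) ^ 2 * (2 * (‖zs‖ ^ 2 + γ ^ 2)))) := by
    gcongr
  unfold rateConst
  linarith

/-- Stationarity of the proximal step bounds the error of the active multipliers by the primal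
step and the primal error. -/
lemma IsKKT.dual_error_le [Nontrivial (Vec n)] (hK : P.IsKKT xs ys zs) (R : P.Regular X Lg L B)
    (hxs : xs ∈ interior X) {β γ μ η ν : ℝ} (hβ : 0 < β) {J K : Finset (Fin m)} (hJK : J ⊆ K)
    (hJ : ∀ j ∈ J, P.f j xs = 0) (hJ' : ∀ j ∉ J, zs j = 0)
    (hγ : P.AdmissibleRadius X J β μ L xs ys zs γ)
    (hν : ∀ v : EuclideanSpace ℝ (Fin p ⊕ K),
      ν * ‖v‖ ^ 2 ≤ ‖(WithLp.toLp 2 (P.D K xs *ᵥ v.ofLp) : Vec n)‖ ^ 2)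
    {x x' : Vec n} {y : Vec p} {z : Vec m} (hx : ‖x - xs‖ ≤ γ) (hz : ‖z - zs‖ ≤ γ)
    (hstat : P.gradF β x y z + η • (x' - x) = 0) :
    ν * (‖y - ys‖ ^ 2 + ∑ j ∈ J, (z j - zs j) ^ 2) ≤
      4 * (η ^ 2 * ‖x' - x‖ ^ 2 + β ^ 2 * ‖P.A‖ ^ 2 * ‖P.lin (x - xs)‖ ^ 2 +
        rateConst J β Lg L B ‖zs‖ γ * ‖x - xs‖ ^ 2) := by
  classical
  have hxX : x ∈ X := interior_subset (hγ.interior x hx)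
  have h1 := gram_bound hν (y - ys) (fun j => if j ∈ J then z j - zs j else 0)
  have e1 : ∑ j ∈ K, (if j ∈ J then z j - zs j else 0) ^ 2 = ∑ j ∈ J, (z j - zs j) ^ 2 := by
    rw [← Finset.sum_subset hJK fun j _ hj => by simp [hj]]
    exact Finset.sum_congr rfl fun j hj => by rw [if_pos hj]
  have e2 : ∑ j ∈ K, (if j ∈ J then z j - zs j else 0) • gradient (P.f j) xs =
      ∑ j ∈ J, (z j - zs j) • gradient (P.f j) xs := by
    rw [← Finset.sum_subset hJK fun j _ hj => by simp [hj]]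
    exact Finset.sum_congr rfl fun j hj => by rw [if_pos hj]
  rw [e1, e2] at h1
  have hs := hK.stationary_of_mem_interior R.h_eq hxs
  rw [← Finset.sum_subset (Finset.subset_univ J) fun j _ hj => by simp [hJ' j hj]] at hs
  rw [P.gradF_eq hβ R.smooth_g R.smooth_f,
    ← Finset.sum_subset (Finset.subset_univ J) (fun j _ hj => by
      rw [max_eq_left (hγ.sign_neg x z hx hz j hj).le, zero_smul]),
    Finset.sum_congr rfl (fun j hj => by rw [max_eq_right (hγ.sign_pos x z hx hz j hj).le])]
    at hstat
  have hres : P.res x = P.lin (x - xs) := by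
    rw [← P.res_sub_res, hK.eq_constr, sub_zero]
  have key : P.adjLin (y - ys) + ∑ j ∈ J, (z j - zs j) • gradient (P.f j) xs =
      -(η • (x' - x)) + -(gradient P.g x - gradient P.g xs) +
        -(β • P.adjLin (P.lin (x - xs))) +
        -(∑ j ∈ J, ((β * P.f j x) • gradient (P.f j) x +
          z j • (gradient (P.f j) x - gradient (P.f j) xs))) := by
    have e3 : ∑ j ∈ J, (z j - zs j) • gradient (P.f j) xs + ∑ j ∈ J, ((β * P.f j x) •
        gradient (P.f j) x + z j • (gradient (P.f j) x - gradient (P.f j) xs)) =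
        ∑ j ∈ J, (β * P.f j x + z j) • gradient (P.f j) x -
          ∑ j ∈ J, zs j • gradient (P.f j) xs := by
      rw [← Finset.sum_add_distrib, ← Finset.sum_sub_distrib]
      exact Finset.sum_congr rfl fun j _ => by module
    rw [← sub_eq_zero]
    rw [← sub_eq_zero, sub_zero] at hstat hs
    rw [map_sub]
    rw [hres, map_add, map_smul] at hstat
    have e4 := congrArg₂ (· - ·) hstat hs
    simp only [sub_zero] at e4
    rw [← e4]
    have e5 := eq_sub_of_add_eq e3
    rw [e5]
    abel
  rw [key] at h1
  have h2 := norm_add_four_sq_le (-(η • (x' - x))) (-(gradient P.g x - gradient P.g xs))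
    (-(β • P.adjLin (P.lin (x - xs)))) (-(∑ j ∈ J, ((β * P.f j x) • gradient (P.f j) x +
          z j • (gradient (P.f j) x - gradient (P.f j) xs))))
  have h3 := norm_active_sum_sq_le R hxs hβ hJ hxX hz
  simp only [norm_neg, norm_smul, mul_pow, Real.norm_eq_abs, sq_abs] at h2
  have h4 := pow_le_pow_left₀ (norm_nonneg _) (R.lip_g x hxX xs (interior_subset hxs)) 2
  have h5 := pow_le_pow_left₀ (norm_nonneg _) (P.norm_adjLin_le (P.lin (x - xs))) 2
  rw [mul_pow] at h4 h5
  have h6 := mul_le_mul_of_nonneg_left h5 (sq_nonneg β)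
  linarith

/-- One step of the method contracts the error, up to the update of the proximal parameter. -/
lemma IsKKT.contraction [Nontrivial (Vec n)] (hK : P.IsKKT xs ys zs) (R : P.Regular X Lg L B)
    (hxs : xs ∈ interior X) {β γ μ δ η ηb ν α : ℝ} (hβ : 0 < β) {J K : Finset (Fin m)}
    (hJK : J ⊆ K) (hJ : ∀ j ∈ J, P.f j xs = 0) (hJ' : ∀ j ∉ J, zs j = 0)
    (hγ : P.AdmissibleRadius X J β μ L xs ys zs γ)
    (hν : ∀ v : EuclideanSpace ℝ (Fin p ⊕ K),
      ν * ‖v‖ ^ 2 ≤ ‖(WithLp.toLp 2 (P.D K xs *ᵥ v.ofLp) : Vec n)‖ ^ 2)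
    (hα : 0 < α) (hαη : α * ηb ^ 2 < δ) (hαA : α * (β * ‖P.A‖ ^ 2) < 1) (hαν : α * (β * ν) ≤ 1)
    {x x' : Vec n} {y y' : Vec p} {z z' : Vec m}
    (hx : ‖x - xs‖ ≤ γ) (hz : ‖z - zs‖ ≤ γ) (hx' : ‖x' - xs‖ ≤ γ)
    (hη0 : 0 ≤ η) (hηb : η ≤ ηb) (hη : P.LF β Lg L B x z + δ ≤ η)
    (hvar : ∀ u ∈ X, 0 ≤ ⟪P.gradF β x y z + η • (x' - x), u - x'⟫)
    (hy : y' = y + (β / 2) • P.res x') (hz' : ∀ j, z' j = z j + β / 2 * P.incr β x' z j) :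
    (μ / 8 + η / 2) * ‖x' - xs‖ ^ 2 + 1 / β * (‖y' - ys‖ ^ 2 + ‖z' - zs‖ ^ 2) ≤
      (α * rateConst J β Lg L B ‖zs‖ γ + η) / 2 * ‖x - xs‖ ^ 2 +
        (1 - α * β * ν / 8) * (1 / β * (‖y - ys‖ ^ 2 + ‖z - zs‖ ^ 2)) := by
  have h1 := hK.step_le R hxs hβ (interior_subset (hγ.interior x hx))
    (interior_subset (hγ.interior x' hx')) hη hvar hy hz'
  have h2 := hK.le_stepGain R hxs hβ hJ' hγ hx' hz
  have h3 := hK.dual_error_le R hxs hβ hJK hJ hJ' hγ hν hx hz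
    (eq_zero_of_variational_of_mem_interior (hγ.interior x' hx') hvar)
  have h4 : ‖z - zs‖ ^ 2 = ∑ j ∈ J, (z j - zs j) ^ 2 + ∑ j ∈ Jᶜ, z j ^ 2 := by
    rw [EuclideanSpace.real_norm_sq_eq, ← Finset.sum_add_sum_compl J]
    congr 1
    exact Finset.sum_congr rfl fun j hj => by simp [hJ' j (Finset.mem_compl.1 hj)]
  have h5 : α * η ^ 2 * ‖x' - x‖ ^ 2 ≤ δ * ‖x' - x‖ ^ 2 := by
    gcongr
    exact (mul_le_mul_of_nonneg_left (pow_le_pow_left₀ hη0 hηb 2) hα.le).trans hαη.le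
  have h6 : α * (β * ‖P.A‖ ^ 2) * (β * ‖P.lin (x - xs)‖ ^ 2) ≤
      1 * (β * ‖P.lin (x - xs)‖ ^ 2) := by gcongr
  have h7 : 0 ≤ ∑ j ∈ Jᶜ, z j ^ 2 := Finset.sum_nonneg fun j _ => sq_nonneg _
  have h8 : α * ν / 8 * ∑ j ∈ Jᶜ, z j ^ 2 ≤ ∑ j ∈ Jᶜ, z j ^ 2 / (4 * β) := by
    rw [← Finset.sum_div, le_div_iff₀ (by positivity)]
    nlinarith [mul_le_mul_of_nonneg_right hαν h7]
  have h9 : (1 - α * β * ν / 8) * (1 / β * (‖y - ys‖ ^ 2 + ‖z - zs‖ ^ 2)) =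
      1 / β * (‖y - ys‖ ^ 2 + ‖z - zs‖ ^ 2) - α / 8 * (ν * (‖y - ys‖ ^ 2 +
        ∑ j ∈ J, (z j - zs j) ^ 2)) - α * ν / 8 * ∑ j ∈ Jᶜ, z j ^ 2 := by
    rw [h4]
    generalize ∑ j ∈ J, (z j - zs j) ^ 2 = s
    generalize ∑ j ∈ Jᶜ, z j ^ 2 = s'
    field_simp
    ring
  have h10 := mul_le_mul_of_nonneg_left h3 (show 0 ≤ α / 8 by positivity)
  rw [h9]
  linarith

end Program

namespace Program

variable {n p m : ℕ} {P : Program n p m} {X : Set (Vec n)} {Lg : ℝ} {L B : Fin m → ℝ}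
variable {xs : Vec n} {ys : Vec p} {zs : Vec m}

/-! ### The Hessian at the KKT point and admissible radii -/

lemma D_transpose_mulVec_eq_zero {J : Finset (Fin m)} {x v : Vec n} (h1 : P.lin v = 0)
    (h2 : ∀ j ∈ J, ⟪gradient (P.f j) x, v⟫ = 0) : (P.D J x)ᵀ *ᵥ v.ofLp = 0 := by
  rw [D, Matrix.transpose_fromCols, Matrix.fromRows_mulVec, Matrix.transpose_transpose]
  have h3 : P.A *ᵥ v.ofLp = 0 := congrArg WithLp.ofLp h1
  rw [h3]
  ext i
  rcases i with i | ⟨j, hj⟩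
  · rfl
  · have := h2 j hj
    rw [EuclideanSpace.inner_eq_star_dotProduct, dotProduct_comm] at this
    simpa [Matrix.mulVec, dotProduct] using this

lemma Regular.hessOn_pos (R : P.Regular X Lg L B) {β : ℝ} (hβ : 0 < β) {J : Finset (Fin m)}
    (hJ : ∀ j ∈ J, P.f j xs = 0 ∧ 0 < zs j)
    (hsosc : ∀ v : Vec n, v ≠ 0 → (P.D J xs)ᵀ *ᵥ v.ofLp = 0 →
      0 < ⟪v, (hess P.g xs + ∑ j ∈ J, zs j • hess (P.f j) xs) v⟫)
    {v : Vec n} (hv : v ≠ 0) : 0 < ⟪v, P.hessOn J β xs zs v⟫ := by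
  have h1 : ⟪v, P.hessOn J β xs zs v⟫ = ⟪v, hess P.g xs v⟫ + β * ‖P.lin v‖ ^ 2 +
      (∑ j ∈ J, zs j * ⟪v, hess (P.f j) xs v⟫ +
        ∑ j ∈ J, β * ⟪gradient (P.f j) xs, v⟫ ^ 2) := by
    rw [inner_hessOn, real_inner_self_eq_norm_sq, ← Finset.sum_add_distrib]
    congr 1
    refine Finset.sum_congr rfl fun j hj => ?_
    rw [(hJ j hj).1]
    ring
  have hg := R.convex_g.inner_hess_nonneg R.smooth_g xs v
  have hl : 0 ≤ β * ‖P.lin v‖ ^ 2 := by positivity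
  have hf : 0 ≤ ∑ j ∈ J, zs j * ⟪v, hess (P.f j) xs v⟫ := Finset.sum_nonneg fun j hj =>
    mul_nonneg (hJ j hj).2.le ((R.convex_f j).inner_hess_nonneg (R.smooth_f j) xs v)
  have hq : ∀ j ∈ J, 0 ≤ β * ⟪gradient (P.f j) xs, v⟫ ^ 2 := fun j _ => by positivity
  have hq' := Finset.sum_nonneg hq
  rw [h1]
  by_contra! hcon
  have hl0 : P.lin v = 0 := by
    have : ‖P.lin v‖ ^ 2 = 0 :=
      (mul_eq_zero.1 (show β * ‖P.lin v‖ ^ 2 = 0 by linarith)).resolve_left hβ.ne'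
    simpa using this
  have hq0 : ∀ j ∈ J, ⟪gradient (P.f j) xs, v⟫ = 0 := by
    intro j hj
    have h2 := (Finset.sum_eq_zero_iff_of_nonneg hq).1 (by linarith) j hj
    simpa [hβ.ne'] using h2
  have h3 := hsosc v hv (D_transpose_mulVec_eq_zero hl0 hq0)
  have h4 : ⟪v, (hess P.g xs + ∑ j ∈ J, zs j • hess (P.f j) xs) v⟫ =
      ⟪v, hess P.g xs v⟫ + ∑ j ∈ J, zs j * ⟪v, hess (P.f j) xs v⟫ := by
    simp only [add_apply, sum_apply, smul_apply, inner_add_right, inner_sum, inner_smul_right]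
  linarith

lemma Regular.hessOn_symm (R : P.Regular X Lg L B) (J : Finset (Fin m)) (β : ℝ) (x : Vec n)
    (z : Vec m) (u v : Vec n) : ⟪P.hessOn J β x z u, v⟫ = ⟪u, P.hessOn J β x z v⟫ := by
  have h : ∀ {φ : Vec n → ℝ}, ContDiff ℝ 2 φ → ⟪v, hess φ x u⟫ = ⟪u, hess φ x v⟫ := fun hφ => by
    rw [real_inner_comm, hφ.inner_hess_comm]
  rw [real_inner_comm, inner_hessOn, inner_hessOn, h R.smooth_g, real_inner_comm (P.lin u)]
  congr 1
  refine Finset.sum_congr rfl fun j _ => ?_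
  rw [h (R.smooth_f j)]
  ring

/-- Admissible radii exist, by continuity of the Hessian away from the kinks of `ψ_β`. -/
lemma Regular.exists_admissibleRadius (R : P.Regular X Lg L B) (hxs : xs ∈ interior X)
    {β μ : ℝ} (hβ : 0 < β) (hμ : 0 < μ) {J : Finset (Fin m)}
    (hpos : ∀ j ∈ J, 0 < β * P.f j xs + zs j) (hneg : ∀ j ∉ J, β * P.f j xs + zs j < 0)
    (hH : ∀ v, μ * ‖v‖ ^ 2 ≤ ⟪v, P.hessOn J β xs zs v⟫) :
    ∃ γ, P.AdmissibleRadius X J β μ L xs ys zs γ := by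
  have hcont : ∀ j, Continuous fun q : Vec n × Vec m => β * P.f j q.1 + q.2 j := fun j => by
    have := (R.smooth_f j).continuous
    fun_prop
  have hosc : Continuous fun q : Vec n × Vec m => ∑ j ∈ J, L j * (β * P.f j q.1 + q.2 j) :=
    continuous_finsetSum _ fun j _ => (hcont j).const_mul (L j)
  have e1 : ∀ᶠ q : Vec n × Vec m in nhds (xs, zs), q.1 ∈ interior X :=
    continuous_fst.continuousAt.eventually (isOpen_interior.mem_nhds hxs)
  have e2 : ∀ᶠ q : Vec n × Vec m in nhds (xs, zs), ∀ j ∈ J, 0 < β * P.f j q.1 + q.2 j := by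
    rw [Filter.eventually_all]
    intro j
    by_cases hj : j ∈ J
    · filter_upwards [(hcont j).continuousAt.eventually (lt_mem_nhds (hpos j hj))] with q hq _
      exact hq
    · simp [hj]
  have e3 : ∀ᶠ q : Vec n × Vec m in nhds (xs, zs), ∀ j ∉ J, β * P.f j q.1 + q.2 j < 0 := by
    rw [Filter.eventually_all]
    intro j
    by_cases hj : j ∈ J
    · simp [hj]
    · filter_upwards [(hcont j).continuousAt.eventually (gt_mem_nhds (hneg j hj))] with q hq _
      exact hq
  have e4 : ∀ᶠ q : Vec n × Vec m in nhds (xs, zs), ∑ j ∈ J, L j * (β * P.f j q.1 + q.2 j) ∈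
      Metric.ball (∑ j ∈ J, L j * (β * P.f j xs + zs j)) (μ / 16) :=
    (hosc.tendsto (xs, zs)) (Metric.ball_mem_nhds _ (by positivity))
  have e5 : ∀ᶠ q : Vec n × Vec m in nhds (xs, zs),
      P.hessOn J β q.1 q.2 ∈ Metric.ball (P.hessOn J β xs zs) (μ / 2) :=
    ((P.continuous_hessOn R.smooth_g R.smooth_f J β).tendsto (xs, zs))
      (Metric.ball_mem_nhds _ (by positivity))
  obtain ⟨ε, hε, hball⟩ := Metric.eventually_nhds_iff.1 (e1.and (e2.and (e3.and (e4.and e5))))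
  have hmem : ∀ (x : Vec n) (z : Vec m), ‖x - xs‖ ≤ ε / 2 → ‖z - zs‖ ≤ ε / 2 →
      dist (x, z) (xs, zs) < ε := by
    intro x z hx hz
    rw [Prod.dist_eq, dist_eq_norm, dist_eq_norm, max_lt_iff]
    constructor <;> dsimp only <;> linarith
  have hz0 : ‖zs - zs‖ ≤ ε / 2 := by rw [sub_self, norm_zero]; positivity
  refine ⟨ε / 2, by positivity, fun x hx => (hball (hmem x zs hx hz0)).1, ?_,
    fun x z hx hz => (hball (hmem x z hx hz)).2.1, fun x z hx hz => (hball (hmem x z hx hz)).2.2.1,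
    ?_⟩
  · intro x y z hx _ hz v
    obtain ⟨-, h2, h3, -, h5⟩ := hball (hmem x z hx hz)
    rw [P.hessF_eq hβ R.smooth_g R.smooth_f h2 h3]
    simp only [Metric.mem_ball, dist_eq_norm] at h5
    have h6 : |⟪v, (P.hessOn J β x z - P.hessOn J β xs zs) v⟫| ≤ μ / 2 * ‖v‖ ^ 2 :=
      calc |⟪v, (P.hessOn J β x z - P.hessOn J β xs zs) v⟫|
          ≤ ‖v‖ * ‖(P.hessOn J β x z - P.hessOn J β xs zs) v‖ := abs_real_inner_le_norm _ _
        _ ≤ ‖v‖ * (μ / 2 * ‖v‖) := by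
            gcongr
            exact (ContinuousLinearMap.le_opNorm _ v).trans (by gcongr)
        _ = μ / 2 * ‖v‖ ^ 2 := by ring
    rw [sub_apply, inner_sub_right] at h6
    linarith [(abs_le.1 h6).1, hH v]
  · intro x x' z z' hx hx' hz hz'
    have h4 := (hball (hmem x z hx hz)).2.2.2.1
    have h4' := (hball (hmem x' z' hx' hz')).2.2.2.1
    simp only [Metric.mem_ball, Real.dist_eq] at h4 h4'
    rw [abs_le]
    rw [abs_lt] at h4 h4'
    constructor <;> linarith

/-! ### Runs of the method -/

lemma prox_min_real (R : P.Regular X Lg L B) (hX : X.Nonempty) {q : Vec n → ℝ} {x' : Vec n}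
    (hmin : IsMinOn (fun u => P.h u + ((q u : ℝ) : EReal)) Set.univ x') :
    x' ∈ X ∧ ∀ u ∈ X, q x' ≤ q u := by
  rw [isMinOn_univ_iff] at hmin
  simp only [R.h_eq, indicatorFn] at hmin
  have hx' : x' ∈ X := by
    by_contra hcon
    obtain ⟨u, hu⟩ := hX
    have := hmin u
    rw [if_neg hcon, if_pos hu, zero_add, EReal.top_add_coe] at this
    exact EReal.coe_ne_top _ (top_le_iff.1 this)
  refine ⟨hx', fun u hu => ?_⟩
  have := hmin u
  rw [if_pos hx', if_pos hu, zero_add, zero_add] at this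
  exact_mod_cast this

section Run

variable {β δ : ℝ} {x : ℕ → Vec n} {y : ℕ → Vec p} {z : ℕ → Vec m} {η : ℕ → ℝ}

lemma IsLALM.LF_add_le (A : P.IsLALM β (β / 2) (β / 2) δ Lg L B x y z η) (k : ℕ) :
    P.LF β Lg L B (x k) (z k) + δ ≤ η k := by
  cases k with
  | zero => rw [A.eta_zero]; exact le_max_right _ _
  | succ k => rw [A.eta_succ]; exact le_max_right _ _

lemma IsLALM.eta_le_succ (A : P.IsLALM β (β / 2) (β / 2) δ Lg L B x y z η) (k : ℕ) :
    η k ≤ η (k + 1) := by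
  rw [A.eta_succ]; exact le_max_left _ _

lemma etaLow_le_LF (hL : ∀ j, 0 ≤ L j) (u : Vec n) (w : Vec m) :
    P.etaLow β Lg B ≤ P.LF β Lg L B u w := by
  unfold etaLow LF
  gcongr with j
  exact le_add_of_nonneg_right (mul_nonneg (hL j) (le_max_left _ _))

lemma IsLALM.x_mem (A : P.IsLALM β (β / 2) (β / 2) δ Lg L B x y z η) (R : P.Regular X Lg L B)
    (hxs : xs ∈ interior X) (hx0 : x 0 ∈ X) (k : ℕ) : x k ∈ X := by
  cases k with
  | zero => exact hx0
  | succ k => exact (prox_min_real R ⟨xs, interior_subset hxs⟩ (A.x_step k)).1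

lemma IsLALM.variational (A : P.IsLALM β (β / 2) (β / 2) δ Lg L B x y z η)
    (R : P.Regular X Lg L B) (hxs : xs ∈ interior X) (k : ℕ) :
    ∀ u ∈ X, 0 ≤ ⟪P.gradF β (x k) (y k) (z k) + η k • (x (k + 1) - x k), u - x (k + 1)⟫ := by
  obtain ⟨h1, h2⟩ := prox_min_real R ⟨xs, interior_subset hxs⟩ (A.x_step k)
  exact fun u hu => variational_of_isMin_prox R.convex_X h1 h2 hu

/-- The squared distance to the KKT point, weighted as in the analysis of the method with
proximal parameter `η` and dual step `β / 2`. -/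
def weightedDist (β : ℝ) (xs : Vec n) (ys : Vec p) (zs : Vec m) (η : ℝ) (x : Vec n) (y : Vec p)
    (z : Vec m) : ℝ :=
  ‖x - xs‖ ^ 2 + (‖y - ys‖ ^ 2 + ‖z - zs‖ ^ 2) / (β / 2 * η)

lemma IsLALM.weightedDist_succ_le (A : P.IsLALM β (β / 2) (β / 2) δ Lg L B x y z η)
    (hK : P.IsKKT xs ys zs) (R : P.Regular X Lg L B) (hxs : xs ∈ interior X) (hβ : 0 < β)
    (hδ : 0 < δ) (hη : ∀ k, 0 < η k) (hx0 : x 0 ∈ X) (k : ℕ) :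
    weightedDist β xs ys zs (η k) (x (k + 1)) (y (k + 1)) (z (k + 1)) ≤
      weightedDist β xs ys zs (η 0) (x 0) (y 0) (z 0) := by
  have step : ∀ k, weightedDist β xs ys zs (η k) (x (k + 1)) (y (k + 1)) (z (k + 1)) ≤
      weightedDist β xs ys zs (η k) (x k) (y k) (z k) := by
    intro k
    have h1 := hK.step_le R hxs hβ (A.x_mem R hxs hx0 k) (A.x_mem R hxs hx0 (k + 1))
      (A.LF_add_le k) (A.variational R hxs k) (A.y_step k) (A.z_step k)
    have h2 := hK.stepGain_nonneg R hxs hβ (x (k + 1)) (z k)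
    have h3 : 0 ≤ δ / 2 * ‖x (k + 1) - x k‖ ^ 2 := by positivity
    have h4 : 0 ≤ β / 2 * ‖P.lin (x k - xs)‖ ^ 2 := by positivity
    have h5 := hη k
    have e : ∀ (u : Vec n) (v : Vec p) (w : Vec m), weightedDist β xs ys zs (η k) u v w =
        2 / η k * (η k / 2 * ‖u - xs‖ ^ 2 + 1 / β * (‖v - ys‖ ^ 2 + ‖w - zs‖ ^ 2)) := by
      intro u v w
      unfold weightedDist
      field_simp
    rw [e, e]
    exact mul_le_mul_of_nonneg_left (by linarith) (by positivity)
  induction k with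
  | zero => exact step 0
  | succ k ih =>
    refine (step (k + 1)).trans (le_trans ?_ ih)
    unfold weightedDist
    have := hη k
    have := A.eta_le_succ k
    gcongr

lemma dual_sq_le_of_weightedDist_le {η W : ℝ} (hβ : 0 < β) (hη : 0 < η) {u : Vec n} {v : Vec p}
    {w : Vec m} (h : weightedDist β xs ys zs η u v w ≤ W) :
    ‖v - ys‖ ^ 2 + ‖w - zs‖ ^ 2 ≤ β / 2 * η * W := by
  have h1 : (‖v - ys‖ ^ 2 + ‖w - zs‖ ^ 2) / (β / 2 * η) ≤ W := by
    unfold weightedDist at h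
    linarith [sq_nonneg ‖u - xs‖]
  rw [div_le_iff₀ (by positivity)] at h1
  linarith

lemma sq_le_of_weightedDist_le {η W : ℝ} (hβ : 0 < β) (hη : 0 < η) {u : Vec n} {v : Vec p}
    {w : Vec m} (h : weightedDist β xs ys zs η u v w ≤ W) : ‖u - xs‖ ^ 2 ≤ W := by
  unfold weightedDist at h
  have : 0 ≤ (‖v - ys‖ ^ 2 + ‖w - zs‖ ^ 2) / (β / 2 * η) := by positivity
  linarith

lemma weightedDist_le_sq {η : ℝ} (hβ : 0 < β) (hη : 0 < η) (u : Vec n) (v : Vec p) (w : Vec m) :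
    weightedDist β xs ys zs η u v w ≤
      (‖u - xs‖ + ‖v - ys‖ / √(β / 2 * η) + ‖w - zs‖ / √(β / 2 * η)) ^ 2 := by
  have h1 : √(β / 2 * η) ^ 2 = β / 2 * η := Real.sq_sqrt (by positivity)
  have h2 : weightedDist β xs ys zs η u v w =
      ‖u - xs‖ ^ 2 + (‖v - ys‖ / √(β / 2 * η)) ^ 2 + (‖w - zs‖ / √(β / 2 * η)) ^ 2 := by
    rw [div_pow, div_pow, h1, weightedDist]
    ring
  rw [h2]
  have a1 : 0 ≤ ‖u - xs‖ := norm_nonneg _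
  have a2 : 0 ≤ ‖v - ys‖ / √(β / 2 * η) := by positivity
  have a3 : 0 ≤ ‖w - zs‖ / √(β / 2 * η) := by positivity
  nlinarith [mul_nonneg a1 a2, mul_nonneg a1 a3, mul_nonneg a2 a3]

/-- A bound on the proximal parameter at a point whose distances to `x*` and `z*` are at most `a`
and `b`. -/
lemma IsKKT.LF_le (hK : P.IsKKT xs ys zs) (R : P.Regular X Lg L B) (hxs : xs ∈ interior X)
    (hβ : 0 < β) (hL : ∀ j, 0 ≤ L j) {u : Vec n} {w : Vec m} {a b : ℝ} (hu : u ∈ X)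
    (ha : ‖u - xs‖ ≤ a) (hb : ‖w - zs‖ ≤ b) :
    P.LF β Lg L B u w ≤ Lg + β * ‖P.A‖ ^ 2 + β * ∑ j, B j ^ 2 + β * (∑ j, B j * L j) * a +
      √(∑ j, L j ^ 2) * (‖zs‖ + b) := by
  have hxs' := interior_subset hxs
  have h1 : ∀ j ∈ Finset.univ, β * B j ^ 2 + L j * max 0 (β * P.f j u + w j) ≤
      β * B j ^ 2 + β * a * (B j * L j) + L j * |w j| := by
    intro j _
    have c := (abs_le.1 (R.abs_f_sub_le j hxs' hu)).2
    have c1 : P.f j u ≤ B j * a := by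
      have := mul_le_mul_of_nonneg_left ha (R.B_nonneg hxs' j)
      linarith [hK.ineq_constr j]
    have c2 : max 0 (β * P.f j u + w j) ≤ β * (B j * a) + |w j| := by
      refine max_le ?_ (add_le_add (mul_le_mul_of_nonneg_left c1 hβ.le) (le_abs_self _))
      have := R.B_nonneg hxs' j
      have := (norm_nonneg _).trans ha
      positivity
    have := mul_le_mul_of_nonneg_left c2 (hL j)
    linarith
  have h2 := Finset.sum_le_sum h1
  simp only [Finset.sum_add_distrib, ← Finset.mul_sum] at h2
  have h3 : ∑ j, L j * |w j| ≤ √(∑ j, L j ^ 2) * ‖w‖ := by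
    have := Real.sum_mul_le_sqrt_mul_sqrt Finset.univ L (fun j => |w j|)
    simpa only [EuclideanSpace.norm_eq, Real.norm_eq_abs, sq_abs] using this
  have h4 : ‖w‖ ≤ ‖zs‖ + b := by
    have := norm_add_le zs (w - zs)
    rw [add_sub_cancel] at this
    linarith
  have h5 := mul_le_mul_of_nonneg_left h4 (Real.sqrt_nonneg (∑ j, L j ^ 2))
  simp only [LF, Finset.sum_add_distrib, ← Finset.mul_sum]
  linarith

lemma EtaBarCond.le {ηb dx dy dz nz η0 : ℝ} (hB : ∀ j, 0 ≤ B j) (hL : ∀ j, 0 ≤ L j)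
    (hβ : 0 < β) (hdx : 0 ≤ dx) (hdy : 0 ≤ dy) (hdz : 0 ≤ dz) (hnz : 0 ≤ nz)
    (h : P.EtaBarCond β (β / 2) (β / 2) δ Lg L B dx dy dz nz η0 ηb) :
    P.etaLow β Lg B + δ ≤ ηb := by
  refine le_trans ?_ h
  have h1 : 0 ≤ β * (∑ j, B j * L j) * (dx + dy / √(β / 2 * η0) + dz / √(β / 2 * η0)) := by
    have := Finset.sum_nonneg fun j (_ : j ∈ Finset.univ) => mul_nonneg (hB j) (hL j)
    positivity
  have h2 : 0 ≤ √(∑ j, L j ^ 2) *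
      (√(β / 2 * ηb) * dx + √(β / 2 * ηb / (β / 2 * η0)) * dy + nz + max 1 √(ηb / η0) * dz) := by
    have : 0 ≤ max 1 √(ηb / η0) := le_max_of_le_left zero_le_one
    positivity
  unfold etaLow
  rw [← Finset.mul_sum]
  linarith

/-- The proximal parameters stay below `ηb`, because the iterates stay near the KKT point. -/
lemma IsLALM.eta_le (A : P.IsLALM β (β / 2) (β / 2) δ Lg L B x y z η)
    (hK : P.IsKKT xs ys zs) (R : P.Regular X Lg L B) (hxs : xs ∈ interior X) (hβ : 0 < β)
    (hδ : 0 < δ) (hL : ∀ j, 0 ≤ L j) (hη : ∀ k, 0 < η k) (hx0 : x 0 ∈ X) {ηb : ℝ} (hηb : 0 < ηb)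
    (hcond : P.EtaBarCond β (β / 2) (β / 2) δ Lg L B
      ‖x 0 - xs‖ ‖y 0 - ys‖ ‖z 0 - zs‖ ‖zs‖ (η 0) ηb) (k : ℕ) : η k ≤ ηb := by
  have hη0 := hη 0
  set dx := ‖x 0 - xs‖ with hdx
  set dy := ‖y 0 - ys‖ with hdy
  set dz := ‖z 0 - zs‖ with hdz
  have hdx0 : 0 ≤ dx := norm_nonneg _
  have hdy0 : 0 ≤ dy := norm_nonneg _
  have hdz0 : 0 ≤ dz := norm_nonneg _
  set a := dx + dy / √(β / 2 * η 0) + dz / √(β / 2 * η 0) with ha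
  set b := √(β / 2 * ηb) * dx + √(β / 2 * ηb / (β / 2 * η 0)) * dy + max 1 √(ηb / η 0) * dz with hb
  have ha0 : 0 ≤ a := by positivity
  have hW := weightedDist_le_sq (xs := xs) (ys := ys) (zs := zs) hβ hη0 (x 0) (y 0) (z 0)
  have hab : √(β / 2 * ηb) * a ≤ b := by
    have e : √(β / 2 * ηb / (β / 2 * η 0)) = √(β / 2 * ηb) / √(β / 2 * η 0) :=
      Real.sqrt_div (by positivity) _
    have e' : √(ηb / η 0) = √(β / 2 * ηb) / √(β / 2 * η 0) := by
      rw [← e, mul_div_mul_left _ _ (by positivity)]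
    have h1 := mul_le_mul_of_nonneg_right (le_max_right 1 √(ηb / η 0)) hdz0
    rw [hb, e]
    rw [e'] at h1 ⊢
    calc √(β / 2 * ηb) * a = √(β / 2 * ηb) * dx + √(β / 2 * ηb) / √(β / 2 * η 0) * dy +
          √(β / 2 * ηb) / √(β / 2 * η 0) * dz := by rw [ha]; ring
      _ ≤ _ := by linarith
  have key : ∀ j, ‖x j - xs‖ ≤ a → ‖z j - zs‖ ≤ b → P.LF β Lg L B (x j) (z j) + δ ≤ ηb := by
    intro j h1 h2
    have h3 := hK.LF_le R hxs hβ hL (A.x_mem R hxs hx0 j) h1 h2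
    have h4 : Lg + β * ‖P.A‖ ^ 2 + β * ∑ j, B j ^ 2 + β * (∑ j, B j * L j) * a +
        √(∑ j, L j ^ 2) * (‖zs‖ + b) + δ ≤ ηb := by
      refine le_trans (le_of_eq ?_) hcond
      rw [hb]
      ring
    linarith
  induction k with
  | zero =>
    rw [A.eta_zero]
    refine max_le hηb.le (key 0 ?_ ?_)
    · have : 0 ≤ dy / √(β / 2 * η 0) := by positivity
      have : 0 ≤ dz / √(β / 2 * η 0) := by positivity
      rw [ha, ← hdx]
      linarith
    · have h1 := mul_le_mul_of_nonneg_right (le_max_left 1 √(ηb / η 0)) hdz0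
      have : 0 ≤ √(β / 2 * ηb) * dx := by positivity
      have : 0 ≤ √(β / 2 * ηb / (β / 2 * η 0)) * dy := by positivity
      rw [hb, ← hdz]
      linarith
  | succ k ih =>
    rw [A.eta_succ]
    have h1 := (A.weightedDist_succ_le hK R hxs hβ hδ hη hx0 k).trans hW
    refine max_le ih (key (k + 1) ?_ ?_)
    · exact le_of_sq_le_sq (sq_le_of_weightedDist_le hβ (hη k) h1) ha0
    · have h2 := dual_sq_le_of_weightedDist_le hβ (hη k) h1
      refine le_trans (le_of_sq_le_sq ?_ (by positivity)) hab
      rw [mul_pow, Real.sq_sqrt (by positivity)]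
      have h3 : β / 2 * η k * a ^ 2 ≤ β / 2 * ηb * a ^ 2 := by gcongr
      linarith [sq_nonneg ‖y (k + 1) - ys‖]

/-- All iterates stay within the admissible radius. -/
lemma IsLALM.mem_ball (A : P.IsLALM β (β / 2) (β / 2) δ Lg L B x y z η)
    (hK : P.IsKKT xs ys zs) (R : P.Regular X Lg L B) (hxs : xs ∈ interior X) (hβ : 0 < β)
    (hδ : 0 < δ) (hη : ∀ k, 0 < η k) (hx0 : x 0 ∈ X) {ηb γ : ℝ} (hγ : 0 < γ)
    (hηb : ∀ k, η k ≤ ηb) (hlow : 0 < P.etaLow β Lg B) (hlow0 : P.etaLow β Lg B ≤ η 0)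
    (hinit : P.InitCond β (β / 2) (β / 2) Lg B ‖x 0 - xs‖ ‖y 0 - ys‖ ‖z 0 - zs‖ γ ηb) (k : ℕ) :
    ‖x k - xs‖ ≤ γ ∧ ‖z k - zs‖ ≤ γ := by
  have hηb0 : 0 < ηb := (hη 0).trans_le (hηb 0)
  have hle : ∀ c, min 1 (min (1 / (β / 2 * ηb)) (1 / (β / 2 * ηb))) ≤ c →
      weightedDist β xs ys zs (P.etaLow β Lg B) (x 0) (y 0) (z 0) ≤ γ ^ 2 * c := by
    intro c hc
    refine le_trans (le_of_eq ?_) (hinit.trans (mul_le_mul_of_nonneg_left hc (sq_nonneg γ)))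
    unfold weightedDist
    ring
  have h1 := hle 1 (min_le_left _ _)
  have h2 := hle (1 / (β / 2 * ηb)) ((min_le_right _ _).trans (min_le_left _ _))
  rw [mul_one] at h1
  have main : ∀ {e : ℝ} {u : Vec n} {v : Vec p} {w : Vec m}, 0 < e → e ≤ ηb →
      weightedDist β xs ys zs e u v w ≤
        weightedDist β xs ys zs (P.etaLow β Lg B) (x 0) (y 0) (z 0) →
      ‖u - xs‖ ≤ γ ∧ ‖w - zs‖ ≤ γ := by
    intro e u v w he heb hw
    refine ⟨le_of_sq_le_sq (sq_le_of_weightedDist_le hβ he (hw.trans h1)) hγ.le,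
      le_of_sq_le_sq ?_ hγ.le⟩
    have h3 := dual_sq_le_of_weightedDist_le hβ he (hw.trans h2)
    have h4 : β / 2 * e * (γ ^ 2 * (1 / (β / 2 * ηb))) = e / ηb * γ ^ 2 := by field_simp
    have h5 : e / ηb * γ ^ 2 ≤ 1 * γ ^ 2 :=
      mul_le_mul_of_nonneg_right ((div_le_one hηb0).2 heb) (sq_nonneg γ)
    linarith [sq_nonneg ‖v - ys‖]
  cases k with
  | zero => exact main hlow (hlow0.trans (hηb 0)) le_rfl
  | succ k =>
    refine main (hη k) (hηb k) ((A.weightedDist_succ_le hK R hxs hβ hδ hη hx0 k).trans ?_)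
    unfold weightedDist
    gcongr

/-- Inside the admissible radius the proximal parameter grows by at most `μ / 8` in a step. -/
lemma IsLALM.eta_succ_le (A : P.IsLALM β (β / 2) (β / 2) δ Lg L B x y z η) {X : Set (Vec n)}
    {J : Finset (Fin m)} {μ γ : ℝ} (hμ : 0 < μ) (hγ : P.AdmissibleRadius X J β μ L xs ys zs γ)
    {k : ℕ} (hx : ‖x k - xs‖ ≤ γ) (hz : ‖z k - zs‖ ≤ γ)
    (hx' : ‖x (k + 1) - xs‖ ≤ γ) (hz' : ‖z (k + 1) - zs‖ ≤ γ) : η (k + 1) ≤ η k + μ / 8 := by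
  have hLF : ∀ {u : Vec n} {w : Vec m}, ‖u - xs‖ ≤ γ → ‖w - zs‖ ≤ γ → P.LF β Lg L B u w =
      Lg + β * ‖P.A‖ ^ 2 + (∑ j, β * B j ^ 2 + ∑ j ∈ J, L j * (β * P.f j u + w j)) := by
    intro u w hu hw
    unfold LF
    rw [Finset.sum_add_distrib]
    congr 2
    rw [← Finset.sum_subset (Finset.subset_univ J) fun j _ hj => by
      rw [max_eq_left (hγ.sign_neg u w hu hw j hj).le, mul_zero]]
    exact Finset.sum_congr rfl fun j hj => by rw [max_eq_right (hγ.sign_pos u w hu hw j hj).le]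
  have h1 := A.LF_add_le k
  have h2 := (abs_le.1 (hγ.osc _ _ _ _ hx' hx hz' hz)).2
  rw [A.eta_succ, hLF hx' hz']
  rw [hLF hx hz] at h1
  exact max_le (by linarith) (by linarith)

end Run

end Program

end

/-! ### Linear convergence -/

theorem mainTheorem3 {n p m : ℕ} (P : Program n p m) (X : Set (Vec n))
    -- `h` is the indicator of a closed convex set; `g`, `f_j` are convex and `C²`
    (hX_closed : IsClosed X) (hX_convex : Convex ℝ X) (hh : P.h = indicatorFn X)
    (hg_convex : ConvexOn ℝ Set.univ P.g) (hf_convex : ∀ j, ConvexOn ℝ Set.univ (P.f j))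
    (hg_smooth : ContDiff ℝ 2 P.g) (hf_smooth : ∀ j, ContDiff ℝ 2 (P.f j))
    (Lg : ℝ) (L B : Fin m → ℝ) (hLip : P.LipData Lg L B)
    -- the nondegenerate KKT point, with active set `J`
    (xs : Vec n) (ys : Vec p) (zs : Vec m) (hKKT : P.IsKKT xs ys zs)
    (hxs : xs ∈ interior X) (J : Finset (Fin m))
    (hJ_active : ∀ j ∈ J, P.f j xs = 0 ∧ 0 < zs j)
    (hJ_inactive : ∀ j ∉ J, P.f j xs < 0 ∧ zs j = 0)
    (hsosc : ∀ v : Vec n, v ≠ 0 → (P.D J xs)ᵀ *ᵥ v.ofLp = 0 →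
      0 < ⟪v, (hess P.g xs + ∑ j ∈ J, zs j • hess (P.f j) xs) v⟫)
    -- `D = [Aᵀ, (∇f_j(x*))_{j ∈ K}]` has at least one column and full column rank
    (K : Finset (Fin m)) (hJK : J ⊆ K) (hcol : 0 < p + K.card)
    (hrank : (P.D K xs).rank = p + K.card)
    (β δ : ℝ) (hβ : 0 < β) (hδ : 0 < δ) :
    -- the smallest eigenvalues `μ` of `∇²_x 𝓛_β(x*, y*, z*)` and `ν` of `Dᵀ D` are positive
    ∃ μ ν : ℝ, IsLeast (spectrum ℝ (P.hessF β xs ys zs)) μ ∧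
      IsLeast (spectrum ℝ ((P.D K xs)ᵀ * P.D K xs)) ν ∧ 0 < μ ∧ 0 < ν ∧
      (∃ γ : ℝ, P.AdmissibleRadius X J β μ L xs ys zs γ) ∧
      ∀ γ : ℝ, P.AdmissibleRadius X J β μ L xs ys zs γ →
      ∀ (x : ℕ → Vec n) (y : ℕ → Vec p) (z : ℕ → Vec m) (η : ℕ → ℝ),
        P.IsLALM β (β / 2) (β / 2) δ Lg L B x y z η →
      ∀ ηb : ℝ,
        P.EtaBarCond β (β / 2) (β / 2) δ Lg L B
          ‖x 0 - xs‖ ‖y 0 - ys‖ ‖z 0 - zs‖ ‖zs‖ (η 0) ηb →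
        P.InitCond β (β / 2) (β / 2) Lg B ‖x 0 - xs‖ ‖y 0 - ys‖ ‖z 0 - zs‖ γ ηb →
      -- `0 < α < min(μ/(8C), δ/η̄², 1/(β‖A‖²))`, where `1/0 = +∞`
      ∀ α : ℝ, 0 < α → α * (8 * rateConst J β Lg L B ‖zs‖ γ) < μ → α * ηb ^ 2 < δ →
        α * (β * ‖P.A‖ ^ 2) < 1 →
        rateFactor α β μ ν (rateConst J β Lg L B ‖zs‖ γ) ηb < 1 ∧
        ∀ k : ℕ,
          lyapunov β μ (η (k + 1)) xs ys zs (x (k + 1)) (y (k + 1)) (z (k + 1)) ≤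
            rateFactor α β μ ν (rateConst J β Lg L B ‖zs‖ γ) ηb *
              lyapunov β μ (η k) xs ys zs (x k) (y k) (z k) := by
  -- full column rank with at least one column forces `n > 0`
  have hn : Nontrivial (Vec n) := by
    have h1 := (P.D K xs).rank_le_card_height
    rw [Fintype.card_fin] at h1
    have : Nonempty (Fin n) := ⟨⟨0, by omega⟩⟩
    infer_instance
  have R : P.Regular X Lg L B :=
    ⟨hX_convex, hh, hg_convex, hf_convex, hg_smooth, hf_smooth, hLip⟩
  have hxX := interior_subset hxs
  have hL := R.L_nonneg hxs
  have hLg := R.Lg_nonneg hxs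
  have hB := R.B_nonneg hxX
  have hpos : ∀ j ∈ J, 0 < β * P.f j xs + zs j := fun j hj => by
    rw [(hJ_active j hj).1, mul_zero, zero_add]; exact (hJ_active j hj).2
  have hneg : ∀ j ∉ J, β * P.f j xs + zs j < 0 := fun j hj => by
    rw [(hJ_inactive j hj).2, add_zero]; exact mul_neg_of_pos_of_neg hβ (hJ_inactive j hj).1
  obtain ⟨μ, hμ, hHμ, v, hv, hTv⟩ := exists_isLeast_spectrum (R.hessOn_symm J β xs zs)
  have hμ0 : 0 < μ := by
    have h1 := R.hessOn_pos hβ hJ_active hsosc hv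
    rw [hTv, inner_smul_right, real_inner_self_eq_norm_sq] at h1
    exact pos_of_mul_pos_left h1 (sq_nonneg _)
  have : Nonempty (Fin p ⊕ K) := by
    rw [← Fintype.card_pos_iff]
    simpa using hcol
  obtain ⟨ν, hν, hν0, hDν⟩ :=
    exists_isLeast_spectrum_gram (P.D K xs) (Program.D_mulVec_injective hrank)
  have hβν := Program.mul_le_etaLow R hxs hcol hβ hDν
  have hlow : 0 < P.etaLow β Lg B := (mul_pos hβ hν0).trans_le hβν
  refine ⟨μ, ν, ?_, hν, hμ0, hν0, R.exists_admissibleRadius hxs hβ hμ0 hpos hneg hHμ, ?_⟩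
  · rw [P.hessF_eq hβ hg_smooth hf_smooth hpos hneg]; exact hμ
  intro γ hγ x y z η A ηb hcond hinit α hα hαC hαη hαA
  set C := rateConst J β Lg L B ‖zs‖ γ with hC
  have hlowη : ∀ k, P.etaLow β Lg B + δ ≤ η k := fun k =>
    (add_le_add_left (Program.etaLow_le_LF hL (x k) (z k)) δ).trans (A.LF_add_le k)
  have hη : ∀ k, 0 < η k := fun k => by linarith [hlowη k]
  have hηb_low : P.etaLow β Lg B + δ ≤ ηb :=
    hcond.le hB hL hβ (norm_nonneg _) (norm_nonneg _) (norm_nonneg _) (norm_nonneg _)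
  have hηb0 : 0 < ηb := by linarith
  have hx0γ : ‖x 0 - xs‖ ≤ γ := by
    refine le_of_sq_le_sq ?_ hγ.pos.le
    have h1 : γ ^ 2 * min 1 (min (1 / (β / 2 * ηb)) (1 / (β / 2 * ηb))) ≤ γ ^ 2 * 1 :=
      mul_le_mul_of_nonneg_left (min_le_left _ _) (sq_nonneg γ)
    have h2 : 0 ≤ 1 / (β / 2 * P.etaLow β Lg B) * ‖y 0 - ys‖ ^ 2 := by positivity
    have h3 : 0 ≤ 1 / (β / 2 * P.etaLow β Lg B) * ‖z 0 - zs‖ ^ 2 := by positivity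
    have h4 := hinit.trans h1
    linarith
  have hx0 : x 0 ∈ X := interior_subset (hγ.interior _ hx0γ)
  have hηb : ∀ k, η k ≤ ηb := A.eta_le hKKT R hxs hβ hδ hL hη hx0 hηb0 hcond
  have hball : ∀ k, ‖x k - xs‖ ≤ γ ∧ ‖z k - zs‖ ≤ γ :=
    A.mem_ball hKKT R hxs hβ hδ hη hx0 hγ.pos hηb hlow (by linarith [hlowη 0]) hinit
  -- `α η̄ < δ / η̄ ≤ 1` since `α η̄² < δ ≤ η̄`
  have hαηb : α * ηb ≤ 1 := by
    have h1 : α * ηb * ηb < 1 * ηb := by linarith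
    exact (lt_of_mul_lt_mul_right h1 hηb0.le).le
  have hαν : α * (β * ν) ≤ 1 :=
    (mul_le_mul_of_nonneg_left (by linarith) hα.le).trans hαηb
  have hαβν : 0 < α * β * ν := by positivity
  refine ⟨max_lt ((div_lt_one (by positivity)).2 (by linarith)) (by linarith), fun k => ?_⟩
  have hstep := hKKT.contraction R hxs hβ hJK (fun j hj => (hJ_active j hj).1)
    (fun j hj => (hJ_inactive j hj).2) hγ hDν hα hαη hαA hαν (hball k).1 (hball k).2
    (hball (k + 1)).1 (hη k).le (hηb k) (A.LF_add_le k) (A.variational R hxs k)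
    (A.y_step k) (A.z_step k)
  have hηsucc := A.eta_succ_le hμ0 hγ (hball k).1 (hball k).2 (hball (k + 1)).1 (hball (k + 1)).2
  have h1 : (μ / 16 + η (k + 1) / 2) * ‖x (k + 1) - xs‖ ^ 2 ≤
      (μ / 8 + η k / 2) * ‖x (k + 1) - xs‖ ^ 2 :=
    mul_le_mul_of_nonneg_right (by linarith) (sq_nonneg _)
  -- `(αC + η) / (μ/8 + η)` increases with `η`
  have h2 : (α * C + η k) / 2 ≤ rateFactor α β μ ν C ηb * (μ / 16 + η k / 2) := by
    have h3 : (α * C + ηb) / (μ / 8 + ηb) ≤ rateFactor α β μ ν C ηb := le_max_left _ _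
    have h4 : (α * C + η k) / 2 ≤ (α * C + ηb) / (μ / 8 + ηb) * (μ / 16 + η k / 2) := by
      rw [div_mul_eq_mul_div, le_div_iff₀ (by positivity)]
      have h5 : 0 ≤ (μ / 8 - α * C) * (ηb - η k) :=
        mul_nonneg (by linarith) (sub_nonneg.2 (hηb k))
      linarith
    have := hη k
    exact h4.trans (mul_le_mul_of_nonneg_right h3 (by positivity))
  have h6 : (1 - α * β * ν / 8) * (1 / β * (‖y k - ys‖ ^ 2 + ‖z k - zs‖ ^ 2)) ≤
      rateFactor α β μ ν C ηb * (1 / β * (‖y k - ys‖ ^ 2 + ‖z k - zs‖ ^ 2)) :=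
    mul_le_mul_of_nonneg_right (le_max_right _ _) (by positivity)
  have h7 := mul_le_mul_of_nonneg_right h2 (sq_nonneg ‖x k - xs‖)
  unfold lyapunov
  linarith
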